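/- Let $p\in\mathbb{Q}$ with $p>2$, write $1/p=a/b$ with coprime positive integers $a,b$, let $k=\lceil\log_2(b+1)\rceil$ (so $k\ge2$) and $\theta_p=(2/p)^{2/(p-2)}-(2/p)^{p/(p-2)}$. Let $m,n\ge1$ and $A\in\mathbb{R}^{m\times n}$. Write $\langle\cdot,\cdot\rangle$ for the Frobenius inner product, $D(\boldsymbol v)$ for the diagonal matrix with diagonal $\boldsymbol v$, $\|\boldsymbol x\|_p=(\sum_i|x_i|^p)^{1/p}$, and $B(Z)=\begin{pmatrix}O&Z/2\\Z^{\mathrm T}/2&O\end{pmatrix}$. Define the spectral and nuclear $p$-norms $$\|A\|_{p_\sigma}=\max\{\boldsymbol x^{\mathrm T}A\boldsymbol y:\|\boldsymbol x\|_p=\|\boldsymbol y\|_p=1\},$$ $$\|A\|_{p_*}=\min\Big\{\sum_{i=1}^r|\lambda_i|:A=\sum_{i=1}^r\lambda_i\boldsymbol x_i\boldsymbol y_i^{\mathrm T},\ \|\boldsymbol x_i\|_p=\|\boldsymbol y_i\|_p=1,\ r\ge 1\Big\},$$ and $$\|A\|_{p_v}=\max\Big\{\langle B(A),X\rangle:\sum_{i=1}^m|x_{ii}|^{p/2}\le1,\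 \sum_{i=m+1}^{m+n}|x_{ii}|^{p/2}\le1,\ X\succeq O\Big\},\qquad \|A\|_{p_u}=\max\{\langle A,Z\rangle:\|Z\|_{p_v}\le1\}.$$ Let $\delta_G$ be the real Grothendieck constant, i.e. the least $K$ such that, for all $m,n,d\ge 1$ and every real $m\times n$ matrix $(c_{ij})$ with $|\sum_{i,j}c_{ij}s_it_j|\le1$ for all real $|s_i|,|t_j|\le1$, one has $|\sum_{i,j}c_{ij}\langle \boldsymbol x_i,\boldsymbol y_j\rangle|\le K$ for all $\boldsymbol x_i,\boldsymbol y_j$ in the Euclidean unit ball of $\mathbb{R}^d$. Let $\mathbb{K}^3_p$ be the set of $(u,v,t)\in\mathbb{R}^3$ with $u,v,t\ge0$ for which there are vectors $\boldsymbol z^i\in\mathbb{R}^{2^i}$, $\boldsymbol z^i\ge\boldsymbol 0$ $(1\le i\le k-1)$, satisfying the following linear and second-order cone constraints: $$\begin{cases}\|(v,\tfrac12(z^1_1-z^1_2))\|_2\le\tfrac12(z^1_1+z^1_2)\\ \|(z^i_j,\tfrac12(z^{i+1}_{2j-1}-z^{i+1}_{2j}))\|_2\le\tfrac12(z^{i+1}_{2j-1}+z^{i+1}_{2j})&1\le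 i\le k-2,\ 1\le j\le2^i\\ z^{k-1}_j\le u&1\le j\le a\\ z^{k-1}_j\le t&a+1\le j\le\lfloor b/2\rfloor\\ \|(z^{k-1}_j,\tfrac12(t-v))\|_2\le\tfrac12(t+v)&\lfloor b/2\rfloor+1\le j\le\lceil b/2\rceil\\ z^{k-1}_j\le v&\lceil b/2\rceil+1\le j\le2^{k-1}.\end{cases}$$ Then the following hold. 1. $\mathbb{K}^3_p=\{(u,v,t)\in\mathbb{R}^3_{\ge 0}:v^{p/(p-2)}\le t\,u^{2/(p-2)}\}$. 2. $\|A\|_{p_v}$ is the (attained) minimum of $u_1+u_2+\theta_p\sum_{i=1}^{m+n}t_i$ over $u_1,u_2\in\mathbb{R}$, $\boldsymbol v,\boldsymbol t\in\mathbb{R}^{m+n}$ subject to $(u_1,v_i,t_i)\in\mathbb{K}^3_p$ for $1\le i\le m$, $(u_2,v_i,t_i)\in\mathbb{K}^3_p$ for $m+1\le i\le m+n$, and $D(\boldsymbol v)\succeq B(A)$. 3. $\|A\|_{p_u}$ is the (attained) optimal value of the program $$\begin{array}{lll}(\mathrm P)&\max&\langle A,Z\rangle\\&\text{s.t.}&u_1+u_2+\theta_p\sum_{i=1}^{m+n}t_i\le1,\\&&(u_1,v_i,t_i)\in\mathbb{K}^3_p,\quad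 i=1,\dots,m,\\&&(u_2,v_i,t_i)\in\mathbb{K}^3_p,\quad i=m+1,\dots,m+n,\\&&D(\boldsymbol v)\succeq B(Z)\end{array}$$ in the variables $Z\in\mathbb{R}^{m\times n}$, $u_1,u_2\in\mathbb{R}$, $\boldsymbol v,\boldsymbol t\in\mathbb{R}^{m+n}$. 4. $\|A\|_{p_u}\le\|A\|_{p_*}\le\delta_G\|A\|_{p_u}$. 5. Every optimal solution $Z$ of $(\mathrm P)$ satisfies $\|Z\|_{p_\sigma}\le1$ and $\langle A,Z\rangle\ge\|A\|_{p_*}/\delta_G$. -/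

import Mathlib

namespace NuclearP

open Matrix

noncomputable section

/-- The `ℓ_p`-norm of a real vector, for a finite exponent `p`. -/
def ellNorm (p : ℝ) {ι : Type*} [Fintype ι] (x : ι → ℝ) : ℝ :=
  (∑ i, |x i| ^ p) ^ (1 / p)

/-- The Frobenius inner product of two real matrices. -/
def frob {ι κ : Type*} [Fintype ι] [Fintype κ] (A B : Matrix ι κ ℝ) : ℝ :=
  ∑ i, ∑ j, A i j * B i j

/-- The matrix spectral `p`-norm: the maximum of `⟨A, x ⊗ y⟩` over `ℓ_p`-unit vectors `x`, `y`. -/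
def spectralPNorm (p : ℝ) {m n : ℕ} (A : Matrix (Fin m) (Fin n) ℝ) : ℝ :=
  sSup {s : ℝ | ∃ (x : Fin m → ℝ) (y : Fin n → ℝ),
    ellNorm p x = 1 ∧ ellNorm p y = 1 ∧ s = frob A (vecMulVec x y)}

/-- The matrix nuclear `p`-norm: the minimum of `∑ |λ i|` over all decompositions
`A = ∑ λ i • (x i ⊗ y i)` into outer products of `ℓ_p`-unit vectors. -/
def nuclearPNorm (p : ℝ) {m n : ℕ} (A : Matrix (Fin m) (Fin n) ℝ) : ℝ :=
  sInf {s : ℝ | ∃ r : ℕ, 0 < r ∧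
    ∃ (lam : Fin r → ℝ) (x : Fin r → Fin m → ℝ) (y : Fin r → Fin n → ℝ),
      (∀ i, ellNorm p (x i) = 1) ∧ (∀ i, ellNorm p (y i) = 1) ∧
      A = ∑ i, lam i • vecMulVec (x i) (y i) ∧ s = ∑ i, |lam i|}

/-- The symmetric block matrix `[O, A/2; Aᵀ/2, O]` of size `m + n`; its rows and columns are
indexed by the disjoint union of the first `m` and the last `n` indices. -/
def symBlock {m n : ℕ} (A : Matrix (Fin m) (Fin n) ℝ) :
    Matrix (Fin m ⊕ Fin n) (Fin m ⊕ Fin n) ℝ :=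
  fromBlocks 0 ((1 / 2 : ℝ) • A) ((1 / 2 : ℝ) • Aᵀ) 0

/-- The convex relaxation `‖A‖_{p_v}` of the spectral `p`-norm. -/
def vNorm (p : ℝ) {m n : ℕ} (A : Matrix (Fin m) (Fin n) ℝ) : ℝ :=
  sSup {s : ℝ | ∃ X : Matrix (Fin m ⊕ Fin n) (Fin m ⊕ Fin n) ℝ,
    ∑ i : Fin m, |X (Sum.inl i) (Sum.inl i)| ^ (p / 2) ≤ 1 ∧
    ∑ j : Fin n, |X (Sum.inr j) (Sum.inr j)| ^ (p / 2) ≤ 1 ∧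
    X.PosSemidef ∧ s = frob (symBlock A) X}

/-- `‖A‖_{p_u}`, the dual norm of `‖·‖_{p_v}`. -/
def uNorm (p : ℝ) {m n : ℕ} (A : Matrix (Fin m) (Fin n) ℝ) : ℝ :=
  sSup {s : ℝ | ∃ Z : Matrix (Fin m) (Fin n) ℝ, vNorm p Z ≤ 1 ∧ s = frob A Z}

/-- The constant `θ_p = (2/p)^{2/(p-2)} - (2/p)^{p/(p-2)}`. -/
def theta (p : ℝ) : ℝ :=
  (2 / p) ^ (2 / (p - 2)) - (2 / p) ^ (p / (p - 2))

/-- The elementary second-order cone constraint `‖(w, (x - y)/2)‖₂ ≤ (x + y)/2`. -/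
def SOC (w x y : ℝ) : Prop :=
  ‖!₂[w, (x - y) / 2]‖ ≤ (x + y) / 2

/-- The system of linear and second-order cone constraints in `u, v, t` and the auxiliary
variables `z i j` (`1 ≤ i ≤ k - 1`, `1 ≤ j ≤ 2 ^ i`; no other values of `z` occur), attached to
`1 / p = a / b` and to `k`. -/
structure SOCSystem (a b k : ℕ) (u v t : ℝ) (z : ℕ → ℕ → ℝ) : Prop where
  root : SOC v (z 1 1) (z 1 2)
  tree : ∀ i j : ℕ, 1 ≤ i → i + 2 ≤ k → 1 ≤ j → j ≤ 2 ^ i →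
    SOC (z i j) (z (i + 1) (2 * j - 1)) (z (i + 1) (2 * j))
  leaf_u : ∀ j : ℕ, 1 ≤ j → j ≤ a → z (k - 1) j ≤ u
  leaf_t : ∀ j : ℕ, a + 1 ≤ j → j ≤ b / 2 → z (k - 1) j ≤ t
  leaf_tv : ∀ j : ℕ, b / 2 + 1 ≤ j → j ≤ (b + 1) / 2 → SOC (z (k - 1) j) t v
  leaf_v : ∀ j : ℕ, (b + 1) / 2 + 1 ≤ j → j ≤ 2 ^ (k - 1) → z (k - 1) j ≤ v
  z_nonneg : ∀ i j : ℕ, 1 ≤ i → i + 1 ≤ k → 1 ≤ j → j ≤ 2 ^ i → 0 ≤ z i j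
  u_nonneg : 0 ≤ u
  v_nonneg : 0 ≤ v
  t_nonneg : 0 ≤ t

/-- The triples `(u, v, t)` that extend to a solution of the second-order cone system with
`1 / p = a / b` in lowest terms (so `a` is the denominator and `b` the numerator of `p > 0`) and
`k = ⌈log₂ (b + 1)⌉`. -/
def socCone (p : ℚ) : Set (ℝ × ℝ × ℝ) :=
  {w | ∃ z : ℕ → ℕ → ℝ,
    SOCSystem p.den p.num.natAbs (Nat.clog 2 (p.num.natAbs + 1)) w.1 w.2.1 w.2.2 z}

/-- The conic constraints on `u₁, u₂, v, t` for a given matrix `A`. -/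
structure ConicFeasible (p : ℚ) {m n : ℕ} (A : Matrix (Fin m) (Fin n) ℝ)
    (u₁ u₂ : ℝ) (v t : Fin m ⊕ Fin n → ℝ) : Prop where
  cone_left : ∀ i : Fin m, (u₁, v (Sum.inl i), t (Sum.inl i)) ∈ socCone p
  cone_right : ∀ j : Fin n, (u₂, v (Sum.inr j), t (Sum.inr j)) ∈ socCone p
  psd : (diagonal v - symBlock A).PosSemidef

/-- The set of objective values of the minimization program for `‖A‖_{p_v}`. -/
def vProgramValues (p : ℚ) {m n : ℕ} (A : Matrix (Fin m) (Fin n) ℝ) : Set ℝ :=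
  {s | ∃ (u₁ u₂ : ℝ) (v t : Fin m ⊕ Fin n → ℝ),
    ConicFeasible p A u₁ u₂ v t ∧ s = u₁ + u₂ + theta p * ∑ i, t i}

/-- The matrices `Z` that are feasible, with suitable values of the other variables, for the
maximization program for `‖A‖_{p_u}`. -/
def uProgramFeasible (p : ℚ) (m n : ℕ) : Set (Matrix (Fin m) (Fin n) ℝ) :=
  {Z | ∃ (u₁ u₂ : ℝ) (v t : Fin m ⊕ Fin n → ℝ),
    u₁ + u₂ + theta p * ∑ i, t i ≤ 1 ∧ ConicFeasible p Z u₁ u₂ v t}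

/-- `Z` is an optimal solution of the program: maximize `⟨A, Z⟩` over the feasible `Z`. -/
def IsOptimalZ (p : ℚ) {m n : ℕ} (A Z : Matrix (Fin m) (Fin n) ℝ) : Prop :=
  Z ∈ uProgramFeasible p m n ∧ ∀ Z' ∈ uProgramFeasible p m n, frob A Z' ≤ frob A Z

/-- `K` is an admissible constant in the (real) Grothendieck inequality. Finitely many vectors of
a real Hilbert space lie in a Euclidean space, so it suffices to consider these, in every
dimension `d`. -/
def IsGrothendieckBound (K : ℝ) : Prop :=
  ∀ (m n d : ℕ) (A : Matrix (Fin m) (Fin n) ℝ),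
    (∀ (s : Fin m → ℝ) (t : Fin n → ℝ), (∀ i, |s i| ≤ 1) → (∀ j, |t j| ≤ 1) →
      |∑ i, ∑ j, A i j * (s i * t j)| ≤ 1) →
    ∀ (x : Fin m → EuclideanSpace ℝ (Fin d)) (y : Fin n → EuclideanSpace ℝ (Fin d)),
      (∀ i, ‖x i‖ ≤ 1) → (∀ j, ‖y j‖ ≤ 1) →
      |∑ i, ∑ j, A i j * inner ℝ (x i) (y j)| ≤ K

/-- The (real) Grothendieck constant: the smallest admissible constant in the Grothendieck
inequality. -/
def grothendieckConstant : ℝ :=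
  sInf {K : ℝ | IsGrothendieckBound K}

end

end NuclearP

/-!
The cone identity rests on a binary tree. A second-order cone constraint on `(w, x, y)` says that
`w ^ 2 ≤ x * y` with `x, y ≥ 0` (`soc_iff`), and each leaf constraint has the same shape with two
labels out of `u`, `t`, `v`. With `2 ^ k` labels in total, of which `2a` are `u`, `b - 2a` are `t` and
the others are `v`, multiplying up the tree gives `v ^ 2 ^ k ≤ u ^ (2a) * t ^ (b - 2a) * v ^ (2 ^ k - b)`,
that is `v ^ b ≤ u ^ (2a) * t ^ (b - 2a)`; conversely, iterated geometric means of the labels solve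
the system (`mem_socCone_iff`).

On the boundary of the cone, Young's inequality bounds `∑ v i * x i` by `u + theta p * ∑ t i` for `x`
in the unit ball of `ℓ_{p/2}` (`mul_le_theta_mul_add`), and for fixed `v` equality is attained
(`exists_mem_socCone_eq_sum_mul`), so the objective of the conic program is the support function of
the diagonal constraints in `vNorm`. Strong duality then follows by separating the cone of all
`(diag X, ⟨B(A), X⟩)`, with `X` positive semidefinite, from an open convex set
(`exists_diagonal_dual`); since `X = 0` is strictly feasible for the diagonal constraints, the
separating hyperplane is never vertical and yields an optimal `v` (`isLeast_vProgramValues`). Hence the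
feasible set of the program for `uNorm` is the compact unit ball of `vNorm`.

A rank-one feasible `X` shows that `vNorm` dominates the spectral norm. Conversely a feasible `X` is a
Gram matrix; absorbing the lengths of the Gram vectors into `A` leaves a bilinear form in unit vectors,
and the Grothendieck inequality bounds `vNorm` by `grothendieckConstant` times the spectral norm
(`vNorm_le_of_frob_vecMulVec_le`). The comparison of the dual norms follows, the nuclear norm being
dual to the spectral norm by the Hahn–Banach theorem (`exists_frob_eq_nuclearPNorm`).

The Grothendieck constant is an infimum, meaningful only if some constant is admissible. The bound `98`
is obtained by representing vectors as combinations of random signs and truncating them: the fourth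
moment bound of `exists_rademacher` makes the remainders small, so that any finite bound `K` improves to
`49 + K / 2` (`abs_sum_mul_inner_le_of_bound`).
-/

namespace NuclearP

open Matrix

/-! ### The second-order cone representation -/

theorem soc_iff {w x y : ℝ} : SOC w x y ↔ 0 ≤ x ∧ 0 ≤ y ∧ w ^ 2 ≤ x * y := by
  unfold SOC
  rw [EuclideanSpace.norm_eq, Real.sqrt_le_iff]
  simp only [Fin.sum_univ_two, Real.norm_eq_abs, sq_abs, Matrix.cons_val_zero, Matrix.cons_val_one]
  constructor
  · rintro ⟨h₁, h₂⟩
    have h : w ^ 2 ≤ x * y := by linarith [h₂, sq_nonneg w]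
    have hxy : 0 ≤ x * y := (sq_nonneg w).trans h
    refine ⟨?_, ?_, h⟩ <;> by_contra! hneg <;> nlinarith
  · rintro ⟨hx, hy, h⟩
    exact ⟨by linarith, by linarith⟩

theorem prod_range_two_mul (f : ℕ → ℝ) (n : ℕ) :
    ∏ j ∈ Finset.range (2 * n), f j = ∏ j ∈ Finset.range n, f (2 * j) * f (2 * j + 1) := by
  induction n with
  | zero => simp
  | succ n ih =>
    rw [Finset.prod_range_succ, ← ih, mul_add, mul_one, Finset.prod_range_succ,
      Finset.prod_range_succ, mul_assoc]

/-- The labels of an additional bottom level of the binary tree, with `2 ^ k` nodes: each leaf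
constraint on `z (k - 1) (j + 1)` says that its square is at most the product of the labels `2 * j`
and `2 * j + 1`. The mixed constraint, which is present only for odd `b`, is the node whose two
labels are `t` and `v`. -/
def leafLabel (a b : ℕ) (u v t : ℝ) (h : ℕ) : ℝ :=
  if h < 2 * a then u else if h < b then t else v

theorem leafLabel_eq_u {a b : ℕ} (u v t : ℝ) {h : ℕ} (hh : h < 2 * a) :
    leafLabel a b u v t h = u := if_pos hh

theorem leafLabel_eq_t {a b : ℕ} (u v t : ℝ) {h : ℕ} (h₁ : 2 * a ≤ h) (h₂ : h < b) :
    leafLabel a b u v t h = t := by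
  rw [leafLabel, if_neg h₁.not_gt, if_pos h₂]

theorem leafLabel_eq_v {a b : ℕ} (u v t : ℝ) {h : ℕ} (h₁ : 2 * a ≤ h) (h₂ : b ≤ h) :
    leafLabel a b u v t h = v := by
  rw [leafLabel, if_neg h₁.not_gt, if_neg h₂.not_gt]

theorem leafLabel_nonneg {a b : ℕ} {u v t : ℝ} (hu : 0 ≤ u) (hv : 0 ≤ v) (ht : 0 ≤ t) (h : ℕ) :
    0 ≤ leafLabel a b u v t h := by
  unfold leafLabel
  split_ifs <;> assumption

theorem prod_leafLabel {a b N : ℕ} (hab : 2 * a ≤ b) (hbN : b ≤ N) (u v t : ℝ) :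
    ∏ h ∈ Finset.range N, leafLabel a b u v t h = u ^ (2 * a) * t ^ (b - 2 * a) * v ^ (N - b) := by
  obtain ⟨c, rfl⟩ := Nat.exists_eq_add_of_le hab
  obtain ⟨d, rfl⟩ := Nat.exists_eq_add_of_le hbN
  rw [Finset.prod_range_add, Finset.prod_range_add]
  have h₁ : ∏ h ∈ Finset.range (2 * a), leafLabel a (2 * a + c) u v t h = u ^ (2 * a) := by
    rw [Finset.prod_congr rfl (g := fun _ => u), Finset.prod_const, Finset.card_range]
    intro h hh
    simp [leafLabel, Finset.mem_range.1 hh]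
  have h₂ : ∏ h ∈ Finset.range c, leafLabel a (2 * a + c) u v t (2 * a + h) = t ^ c := by
    rw [Finset.prod_congr rfl (g := fun _ => t), Finset.prod_const, Finset.card_range]
    intro h hh
    simp [leafLabel, Finset.mem_range.1 hh]
  have h₃ : ∏ h ∈ Finset.range d, leafLabel a (2 * a + c) u v t (2 * a + c + h) = v ^ d := by
    rw [Finset.prod_congr rfl (g := fun _ => v), Finset.prod_const, Finset.card_range]
    intro h hh
    have : ¬ 2 * a + c + h < 2 * a := by omega
    simp [leafLabel, this]
  rw [h₁, h₂, h₃]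
  congr 2 <;> congr 1 <;> omega

/-- The constraints of the system multiply up along the binary tree. -/
theorem SOCSystem.pow_le_prod {a b k : ℕ} {u v t : ℝ} {z : ℕ → ℕ → ℝ}
    (H : SOCSystem a b k u v t z) (i : ℕ) (hi : i + 2 ≤ k) :
    v ^ 2 ^ (i + 1) ≤ ∏ j ∈ Finset.range (2 ^ (i + 1)), z (i + 1) (j + 1) := by
  induction i with
  | zero =>
    obtain ⟨-, -, h⟩ := soc_iff.1 H.root
    simpa [Finset.prod_range_succ] using h
  | succ i ih =>
    rw [pow_succ 2 (i + 1), pow_mul]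
    calc (v ^ 2 ^ (i + 1)) ^ 2 ≤ (∏ j ∈ Finset.range (2 ^ (i + 1)), z (i + 1) (j + 1)) ^ 2 :=
          pow_le_pow_left₀ (pow_nonneg H.v_nonneg _) (ih (by omega)) 2
      _ = ∏ j ∈ Finset.range (2 ^ (i + 1)), z (i + 1) (j + 1) ^ 2 := by rw [Finset.prod_pow]
      _ ≤ ∏ j ∈ Finset.range (2 ^ (i + 1)),
            z (i + 1 + 1) (2 * j + 1) * z (i + 1 + 1) (2 * j + 1 + 1) := by
          refine Finset.prod_le_prod (fun _ _ => sq_nonneg _) fun j hj => ?_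
          have hj' := Finset.mem_range.1 hj
          obtain ⟨-, -, h⟩ := soc_iff.1
            (H.tree (i + 1) (j + 1) (by omega) (by omega) (by omega) (by omega))
          have e : 2 * (j + 1) - 1 = 2 * j + 1 := by omega
          rwa [e, show 2 * (j + 1) = 2 * j + 1 + 1 by ring] at h
      _ = _ := by
          rw [mul_comm (2 ^ (i + 1)) 2]
          exact (prod_range_two_mul (fun j => z (i + 1 + 1) (j + 1)) _).symm

theorem SOCSystem.leaf_sq_le {a b k : ℕ} {u v t : ℝ} {z : ℕ → ℕ → ℝ}
    (hk : 2 ≤ k) (H : SOCSystem a b k u v t z) {j : ℕ} (hj : j < 2 ^ (k - 1)) :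
    z (k - 1) (j + 1) ^ 2 ≤ leafLabel a b u v t (2 * j) * leafLabel a b u v t (2 * j + 1) := by
  have h0 : 0 ≤ z (k - 1) (j + 1) :=
    H.z_nonneg _ _ (by omega) (by omega) (by omega) (by omega)
  by_cases h₁ : j + 1 ≤ a
  · have := H.leaf_u (j + 1) (by omega) h₁
    rw [leafLabel_eq_u _ _ _ (by omega), leafLabel_eq_u _ _ _ (by omega)]
    nlinarith
  by_cases h₂ : j + 1 ≤ b / 2
  · have := H.leaf_t (j + 1) (by omega) h₂
    rw [leafLabel_eq_t _ _ _ (by omega) (by omega), leafLabel_eq_t _ _ _ (by omega) (by omega)]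
    nlinarith
  by_cases h₃ : j + 1 ≤ (b + 1) / 2
  · obtain ⟨-, -, h⟩ := soc_iff.1 (H.leaf_tv (j + 1) (by omega) h₃)
    rwa [leafLabel_eq_t _ _ _ (by omega) (by omega), leafLabel_eq_v _ _ _ (by omega) (by omega)]
  · have := H.leaf_v (j + 1) (by omega) (by omega)
    rw [leafLabel_eq_v _ _ _ (by omega) (by omega), leafLabel_eq_v _ _ _ (by omega) (by omega)]
    nlinarith

theorem SOCSystem.pow_le {a b k : ℕ} {u v t : ℝ} {z : ℕ → ℕ → ℝ} (hab : 2 * a < b)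
    (hk : 2 ≤ k) (hb : b ≤ 2 ^ k) (H : SOCSystem a b k u v t z) :
    v ^ b ≤ u ^ (2 * a) * t ^ (b - 2 * a) := by
  have hb0 : b ≠ 0 := by omega
  rcases H.v_nonneg.eq_or_lt with hv | hv
  · rw [← hv, zero_pow hb0]
    exact mul_nonneg (pow_nonneg H.u_nonneg _) (pow_nonneg H.t_nonneg _)
  obtain ⟨i, rfl⟩ := Nat.exists_eq_add_of_le hk
  have h₁ := H.pow_le_prod i (by omega)
  have e : 2 + i - 1 = i + 1 := by omega
  have h₂ : v ^ 2 ^ (2 + i) ≤ ∏ h ∈ Finset.range (2 ^ (2 + i)), leafLabel a b u v t h := by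
    rw [show 2 + i = i + 1 + 1 by ring, pow_succ 2 (i + 1), pow_mul, mul_comm _ 2,
      prod_range_two_mul]
    refine (pow_le_pow_left₀ (pow_nonneg hv.le _) h₁ 2).trans ?_
    rw [← Finset.prod_pow]
    refine Finset.prod_le_prod (fun _ _ => sq_nonneg _) fun j hj => ?_
    have := H.leaf_sq_le hk (j := j) (by rw [e]; exact Finset.mem_range.1 hj)
    rwa [e] at this
  rw [prod_leafLabel hab.le hb] at h₂
  have h₃ : v ^ 2 ^ (2 + i) = v ^ b * v ^ (2 ^ (2 + i) - b) := by
    rw [← pow_add, Nat.add_sub_cancel' hb]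
  rw [h₃] at h₂
  exact le_of_mul_le_mul_right h₂ (pow_pos hv _)

/-- Iterated geometric means over the dyadic blocks of a sequence: `geomTree w n j` is the
geometric mean of the `2 ^ n` values `w h` with `2 ^ n * j ≤ h < 2 ^ n * (j + 1)`. -/
noncomputable def geomTree (w : ℕ → ℝ) : ℕ → ℕ → ℝ
  | 0, j => w j
  | n + 1, j => √(geomTree w n (2 * j) * geomTree w n (2 * j + 1))

theorem geomTree_nonneg {w : ℕ → ℝ} (hw : ∀ h, 0 ≤ w h) (n j : ℕ) : 0 ≤ geomTree w n j := by
  cases n with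
  | zero => exact hw j
  | succ n => exact Real.sqrt_nonneg _

theorem geomTree_succ_sq {w : ℕ → ℝ} (hw : ∀ h, 0 ≤ w h) (n j : ℕ) :
    geomTree w (n + 1) j ^ 2 = geomTree w n (2 * j) * geomTree w n (2 * j + 1) :=
  Real.sq_sqrt (mul_nonneg (geomTree_nonneg hw _ _) (geomTree_nonneg hw _ _))

theorem soc_geomTree {w : ℕ → ℝ} (hw : ∀ h, 0 ≤ w h) (n j : ℕ) :
    SOC (geomTree w (n + 1) j) (geomTree w n (2 * j)) (geomTree w n (2 * j + 1)) :=
  soc_iff.2 ⟨geomTree_nonneg hw _ _, geomTree_nonneg hw _ _, (geomTree_succ_sq hw n j).le⟩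

theorem prod_geomTree_pow {w : ℕ → ℝ} (hw : ∀ h, 0 ≤ w h) (n N : ℕ) :
    (∏ j ∈ Finset.range N, geomTree w n j) ^ 2 ^ n = ∏ h ∈ Finset.range (2 ^ n * N), w h := by
  induction n generalizing N with
  | zero => simp [geomTree]
  | succ n ih =>
    rw [pow_succ' 2 n, pow_mul, ← Finset.prod_pow,
      Finset.prod_congr rfl fun j _ => geomTree_succ_sq hw n j, ← prod_range_two_mul, ih]
    congr 2
    ring

theorem exists_socSystem {a b k : ℕ} {u v t : ℝ} (hab : 2 * a < b) (hk : 2 ≤ k) (hb : b ≤ 2 ^ k)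
    (hu : 0 ≤ u) (hv : 0 ≤ v) (ht : 0 ≤ t) (h : v ^ b ≤ u ^ (2 * a) * t ^ (b - 2 * a)) :
    ∃ z, SOCSystem a b k u v t z := by
  set w := leafLabel a b u v t with hwdef
  have hw : ∀ h, 0 ≤ w h := leafLabel_nonneg hu hv ht
  -- the root of the tree is the geometric mean of all labels
  have hroot : v ≤ geomTree w k 0 := by
    have h₁ := prod_geomTree_pow hw k 1
    rw [Finset.prod_range_one, mul_one, hwdef, prod_leafLabel hab.le hb] at h₁
    refine le_of_pow_le_pow_left₀ (n := 2 ^ k) (by positivity) (geomTree_nonneg hw _ _) ?_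
    rw [h₁]
    calc v ^ 2 ^ k = v ^ b * v ^ (2 ^ k - b) := by rw [← pow_add, Nat.add_sub_cancel' hb]
      _ ≤ _ := mul_le_mul_of_nonneg_right h (pow_nonneg hv _)
  obtain ⟨i, rfl⟩ := Nat.exists_eq_add_of_le' hk
  have hleaf : ∀ j, geomTree w (i + 2 - (i + 2 - 1)) j = √(w (2 * j) * w (2 * j + 1)) := by
    intro j
    rw [show i + 2 - (i + 2 - 1) = 0 + 1 by omega]
    rfl
  refine ⟨fun i' j => geomTree w (i + 2 - i') (j - 1), ?_, ?_, ?_, ?_, ?_, ?_, ?_, hu, hv, ht⟩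
  · rw [soc_iff]
    refine ⟨geomTree_nonneg hw _ _, geomTree_nonneg hw _ _, ?_⟩
    have := geomTree_succ_sq hw (i + 1) 0
    calc v ^ 2 ≤ geomTree w (i + 1 + 1) 0 ^ 2 := pow_le_pow_left₀ hv hroot 2
      _ = _ := this
  · intro i' j hi hi' hj _
    have := soc_geomTree hw (i + 2 - (i' + 1)) (j - 1)
    rw [show i + 2 - (i' + 1) + 1 = i + 2 - i' by omega,
      show 2 * (j - 1) = 2 * j - 1 - 1 by omega,
      show 2 * j - 1 - 1 + 1 = 2 * j - 1 by omega] at this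
    exact this
  · intro j hj hja
    rw [hleaf, hwdef, leafLabel_eq_u _ _ _ (by omega), leafLabel_eq_u _ _ _ (by omega),
      Real.sqrt_mul_self hu]
  · intro j hj hjb
    rw [hleaf, hwdef, leafLabel_eq_t _ _ _ (by omega) (by omega),
      leafLabel_eq_t _ _ _ (by omega) (by omega), Real.sqrt_mul_self ht]
  · intro j hj hjb
    rw [hleaf, hwdef, leafLabel_eq_t _ _ _ (by omega) (by omega),
      leafLabel_eq_v _ _ _ (by omega) (by omega), soc_iff, Real.sq_sqrt (mul_nonneg ht hv)]
    exact ⟨ht, hv, le_rfl⟩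
  · intro j hj _
    rw [hleaf, hwdef, leafLabel_eq_v _ _ _ (by omega) (by omega),
      leafLabel_eq_v _ _ _ (by omega) (by omega), Real.sqrt_mul_self hv]
  · intro i' j _ _ _ _
    exact geomTree_nonneg hw _ _

theorem two_mul_den_lt_natAbs_num {p : ℚ} (hp : 2 < p) : 2 * p.den < p.num.natAbs := by
  have hpos : 0 < p.num := Rat.num_pos.2 (by linarith)
  have h := Rat.lt_iff 2 p |>.1 hp
  simp only [Rat.num_ofNat, Rat.den_ofNat] at h
  zify
  rw [abs_of_pos hpos]
  simpa using h

theorem rpow_le_iff_pow_le {p : ℚ} (hp : 2 < p) {u v t : ℝ} (hu : 0 ≤ u) (hv : 0 ≤ v)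
    (ht : 0 ≤ t) :
    v ^ ((p : ℝ) / ((p : ℝ) - 2)) ≤ t * u ^ (2 / ((p : ℝ) - 2)) ↔
      v ^ p.num.natAbs ≤ u ^ (2 * p.den) * t ^ (p.num.natAbs - 2 * p.den) := by
  have hnum := two_mul_den_lt_natAbs_num hp
  have ha : 0 < p.den := p.den_pos
  have hpr : (p : ℝ) = (p.num.natAbs : ℝ) / p.den := by
    have hpos : 0 < p.num := Rat.num_pos.2 (by linarith)
    rw [Rat.cast_def, Nat.cast_natAbs, abs_of_pos hpos]
  set a := p.den
  set b := p.num.natAbs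
  obtain ⟨c, hc⟩ := Nat.exists_eq_add_of_le hnum.le
  have hc0 : 0 < c := by omega
  have ha' : (0 : ℝ) < a := by exact_mod_cast ha
  have hc' : (0 : ℝ) < c := by exact_mod_cast hc0
  have hb' : (b : ℝ) = 2 * a + c := by rw [hc]; push_cast; ring
  have e₁ : (p : ℝ) - 2 = c / a := by rw [hpr, hb']; field_simp; ring
  have e₂ : (p : ℝ) / ((p : ℝ) - 2) * c = b := by rw [e₁, hpr]; field_simp
  have e₃ : 2 / ((p : ℝ) - 2) * c = ((2 * a : ℕ) : ℝ) := by rw [e₁]; push_cast; field_simp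
  rw [← pow_le_pow_iff_left₀ (by positivity) (by positivity) hc0.ne', mul_pow,
    ← Real.rpow_mul_natCast hv, ← Real.rpow_mul_natCast hu, e₂, e₃, Real.rpow_natCast,
    Real.rpow_natCast, mul_comm, show b - 2 * a = c by omega]

theorem mem_socCone_iff {p : ℚ} (hp : 2 < p) {u v t : ℝ} :
    (u, v, t) ∈ socCone p ↔ 0 ≤ u ∧ 0 ≤ v ∧ 0 ≤ t ∧
      v ^ ((p : ℝ) / ((p : ℝ) - 2)) ≤ t * u ^ (2 / ((p : ℝ) - 2)) := by
  have hab := two_mul_den_lt_natAbs_num hp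
  have ha : 0 < p.den := p.den_pos
  have hk : 2 ≤ Nat.clog 2 (p.num.natAbs + 1) := by
    exact (Nat.lt_clog_iff_pow_lt (by norm_num)).2 (by omega)
  have hb : p.num.natAbs ≤ 2 ^ Nat.clog 2 (p.num.natAbs + 1) :=
    (Nat.le_succ _).trans (Nat.le_pow_clog (by norm_num) _)
  constructor
  · rintro ⟨z, H⟩
    exact ⟨H.u_nonneg, H.v_nonneg, H.t_nonneg,
      (rpow_le_iff_pow_le hp H.u_nonneg H.v_nonneg H.t_nonneg).2 (H.pow_le hab hk hb)⟩
  · rintro ⟨hu, hv, ht, h⟩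
    exact exists_socSystem hab hk hb hu hv ht ((rpow_le_iff_pow_le hp hu hv ht).1 h)

/-! ### Positive semidefinite matrices and the Frobenius inner product -/

theorem exists_gram_of_posSemidef {ι : Type*} [Finite ι] {X : Matrix ι ι ℝ} (hX : X.PosSemidef) :
    ∃ (d : ℕ) (g : ι → Fin d → ℝ), ∀ i j, X i j = ∑ k, g i k * g j k := by
  obtain ⟨d, g, rfl⟩ := posSemidef_iff_eq_sum_vecMulVec.1 hX
  exact ⟨d, fun i k => g k i, fun i j => by simp [Matrix.sum_apply, vecMulVec_apply]⟩

theorem posSemidef_vecMulVec_self {ι : Type*} [Finite ι] (x : ι → ℝ) :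
    (vecMulVec x x).PosSemidef := by
  simpa using posSemidef_vecMulVec_self_star x

theorem abs_apply_le_of_posSemidef {ι : Type*} [Finite ι] {X : Matrix ι ι ℝ} (hX : X.PosSemidef)
    (i j : ι) : |X i j| ≤ (X i i + X j j) / 2 := by
  obtain ⟨d, g, hg⟩ := exists_gram_of_posSemidef hX
  rw [hg, hg, hg, ← Finset.sum_add_distrib, Finset.sum_div]
  refine (Finset.abs_sum_le_sum_abs _ _).trans (Finset.sum_le_sum fun k _ => ?_)
  rw [abs_le]
  constructor <;> nlinarith [sq_nonneg (g i k + g j k), sq_nonneg (g i k - g j k)]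

section Frob

variable {ι κ : Type*} [Fintype ι] [Fintype κ]

theorem frob_add_left (A B C : Matrix ι κ ℝ) : frob (A + B) C = frob A C + frob B C := by
  simp [frob, add_mul, Finset.sum_add_distrib]

theorem frob_add_right (A B C : Matrix ι κ ℝ) : frob A (B + C) = frob A B + frob A C := by
  simp [frob, mul_add, Finset.sum_add_distrib]

theorem frob_sub_left (A B C : Matrix ι κ ℝ) : frob (A - B) C = frob A C - frob B C := by
  simp [frob, sub_mul, Finset.sum_sub_distrib]

theorem frob_smul_left (c : ℝ) (A B : Matrix ι κ ℝ) : frob (c • A) B = c * frob A B := by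
  simp [frob, Finset.mul_sum, mul_assoc]

theorem frob_smul_right (c : ℝ) (A B : Matrix ι κ ℝ) : frob A (c • B) = c * frob A B := by
  simp [frob, Finset.mul_sum, mul_left_comm]

theorem frob_comm (A B : Matrix ι κ ℝ) : frob A B = frob B A := by
  simp [frob, mul_comm]

theorem frob_sum_left {σ : Type*} (s : Finset σ) (A : σ → Matrix ι κ ℝ) (B : Matrix ι κ ℝ) :
    frob (∑ k ∈ s, A k) B = ∑ k ∈ s, frob (A k) B := by
  classical
  induction s using Finset.induction_on with
  | empty => simp [frob]
  | insert k s hk ih => rw [Finset.sum_insert hk, Finset.sum_insert hk, frob_add_left, ih]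

theorem continuous_frob_right (A : Matrix ι κ ℝ) : Continuous (frob A) := by
  unfold frob
  fun_prop

theorem frob_vecMulVec_self (M : Matrix ι ι ℝ) (x : ι → ℝ) :
    frob M (vecMulVec x x) = x ⬝ᵥ M *ᵥ x := by
  simp only [frob, vecMulVec_apply, dotProduct, mulVec, Finset.mul_sum]
  exact Finset.sum_congr rfl fun i _ => Finset.sum_congr rfl fun j _ => by ring

theorem frob_nonneg_of_posSemidef {M X : Matrix ι ι ℝ} (hM : M.PosSemidef) (hX : X.PosSemidef) :
    0 ≤ frob M X := by
  obtain ⟨d, g, rfl⟩ := posSemidef_iff_eq_sum_vecMulVec.1 hX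
  rw [frob_comm, frob_sum_left]
  refine Finset.sum_nonneg fun k _ => ?_
  rw [frob_comm, star_trivial, frob_vecMulVec_self]
  simpa using hM.dotProduct_mulVec_nonneg (g k)

theorem frob_diagonal [DecidableEq ι] (v : ι → ℝ) (X : Matrix ι ι ℝ) :
    frob (diagonal v) X = ∑ i, v i * X i i := by
  simp [frob, diagonal_apply]

end Frob

theorem symBlock_isHermitian {m n : ℕ} (A : Matrix (Fin m) (Fin n) ℝ) :
    (symBlock A).IsHermitian := by
  unfold symBlock
  rw [IsHermitian, conjTranspose_eq_transpose_of_trivial, fromBlocks_transpose]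
  simp

theorem frob_symBlock {m n : ℕ} (A : Matrix (Fin m) (Fin n) ℝ)
    {X : Matrix (Fin m ⊕ Fin n) (Fin m ⊕ Fin n) ℝ} (hX : X.PosSemidef) :
    frob (symBlock A) X = ∑ i, ∑ j, A i j * X (Sum.inl i) (Sum.inr j) := by
  have hs : ∀ i j, X (Sum.inr j) (Sum.inl i) = X (Sum.inl i) (Sum.inr j) := fun i j => by
    simpa using hX.1.apply (Sum.inl i) (Sum.inr j)
  simp only [frob, symBlock, Fintype.sum_sum_type, fromBlocks_apply₁₁, fromBlocks_apply₁₂,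
    fromBlocks_apply₂₁, fromBlocks_apply₂₂, Matrix.zero_apply, zero_mul, Finset.sum_const_zero,
    zero_add, add_zero, Matrix.smul_apply, transpose_apply, smul_eq_mul, hs]
  rw [Finset.sum_comm (s := (Finset.univ : Finset (Fin n)))]
  simp only [← Finset.sum_add_distrib]
  exact Finset.sum_congr rfl fun i _ => Finset.sum_congr rfl fun j _ => by ring

/-! ### The relaxed spectral norm -/

/-- The feasible matrices of the maximization problem defining `vNorm p`. -/
structure VFeasible (p : ℝ) {m n : ℕ} (X : Matrix (Fin m ⊕ Fin n) (Fin m ⊕ Fin n) ℝ) : Prop where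
  left : ∑ i : Fin m, |X (Sum.inl i) (Sum.inl i)| ^ (p / 2) ≤ 1
  right : ∑ j : Fin n, |X (Sum.inr j) (Sum.inr j)| ^ (p / 2) ≤ 1
  psd : X.PosSemidef

theorem abs_le_one_of_sum_rpow_le_one {ι : Type*} [Fintype ι] {P : ℝ} (hP : 0 < P) {x : ι → ℝ}
    (h : ∑ i, |x i| ^ P ≤ 1) (i : ι) : |x i| ≤ 1 := by
  by_contra! hi
  have h₁ := Real.one_lt_rpow hi hP
  have h₂ := Finset.single_le_sum (f := fun i => |x i| ^ P)
    (fun i _ => Real.rpow_nonneg (abs_nonneg _) _) (Finset.mem_univ i)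
  exact absurd (h₁.trans_le h₂) (not_lt.2 h)

theorem VFeasible.abs_apply_le_one {p : ℝ} (hp : 0 < p) {m n : ℕ}
    {X : Matrix (Fin m ⊕ Fin n) (Fin m ⊕ Fin n) ℝ} (hX : VFeasible p X) (i j : Fin m ⊕ Fin n) :
    |X i j| ≤ 1 := by
  have hd : ∀ k, X k k ≤ 1 := by
    rintro (k | k)
    · exact (le_abs_self _).trans (abs_le_one_of_sum_rpow_le_one (half_pos hp) hX.left k)
    · exact (le_abs_self _).trans (abs_le_one_of_sum_rpow_le_one (half_pos hp) hX.right k)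
  linarith [abs_apply_le_of_posSemidef hX.psd i j, hd i, hd j]

theorem bddAbove_vNorm {p : ℝ} (hp : 0 < p) {m n : ℕ} (A : Matrix (Fin m) (Fin n) ℝ) :
    BddAbove {s : ℝ | ∃ X : Matrix (Fin m ⊕ Fin n) (Fin m ⊕ Fin n) ℝ,
      ∑ i : Fin m, |X (Sum.inl i) (Sum.inl i)| ^ (p / 2) ≤ 1 ∧
      ∑ j : Fin n, |X (Sum.inr j) (Sum.inr j)| ^ (p / 2) ≤ 1 ∧
      X.PosSemidef ∧ s = frob (symBlock A) X} := by
  refine ⟨∑ i, ∑ j, |A i j|, ?_⟩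
  rintro s ⟨X, h₁, h₂, h₃, rfl⟩
  rw [frob_symBlock A h₃]
  refine Finset.sum_le_sum fun i _ => Finset.sum_le_sum fun j _ => ?_
  have := VFeasible.abs_apply_le_one hp ⟨h₁, h₂, h₃⟩ (Sum.inl i) (Sum.inr j)
  calc _ ≤ |A i j * X (Sum.inl i) (Sum.inr j)| := le_abs_self _
    _ ≤ |A i j| := by
      rw [abs_mul]
      exact mul_le_of_le_one_right (abs_nonneg _) this

theorem VFeasible.frob_le_vNorm {p : ℝ} (hp : 0 < p) {m n : ℕ} (A : Matrix (Fin m) (Fin n) ℝ)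
    {X : Matrix (Fin m ⊕ Fin n) (Fin m ⊕ Fin n) ℝ} (hX : VFeasible p X) :
    frob (symBlock A) X ≤ vNorm p A :=
  le_csSup (bddAbove_vNorm hp A) ⟨X, hX.left, hX.right, hX.psd, rfl⟩

theorem vFeasible_zero {p : ℝ} (hp : 0 < p) {m n : ℕ} :
    VFeasible p (0 : Matrix (Fin m ⊕ Fin n) (Fin m ⊕ Fin n) ℝ) := by
  have : p / 2 ≠ 0 := (half_pos hp).ne'
  refine ⟨?_, ?_, PosSemidef.zero⟩ <;> simp [Real.zero_rpow this]

theorem vNorm_le {p : ℝ} (hp : 0 < p) {m n : ℕ} {A : Matrix (Fin m) (Fin n) ℝ} {c : ℝ}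
    (h : ∀ X, VFeasible p X → frob (symBlock A) X ≤ c) : vNorm p A ≤ c := by
  refine csSup_le ⟨_, 0, (vFeasible_zero hp).left, (vFeasible_zero hp).right,
    (vFeasible_zero hp).psd, rfl⟩ ?_
  rintro s ⟨X, h₁, h₂, h₃, rfl⟩
  exact h X ⟨h₁, h₂, h₃⟩

theorem vNorm_nonneg {p : ℝ} (hp : 0 < p) {m n : ℕ} (A : Matrix (Fin m) (Fin n) ℝ) :
    0 ≤ vNorm p A := by
  have := (vFeasible_zero (m := m) (n := n) hp).frob_le_vNorm hp A
  simpa [frob] using this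

/-! ### Weak duality -/

/-- Young's inequality, in the form in which the constant `theta p` is optimal. -/
theorem mul_le_theta_mul_add {p : ℝ} (hp : 2 < p) {u v t x : ℝ} (hu : 0 ≤ u) (hv : 0 ≤ v)
    (ht : 0 ≤ t) (hx : 0 ≤ x) (h : v ^ (p / (p - 2)) ≤ t * u ^ (2 / (p - 2))) :
    v * x ≤ theta p * t + u * x ^ (p / 2) := by
  have hp0 : 0 < p := by linarith
  have hp2 : 0 < p - 2 := by linarith
  set α := (p - 2) / p with hα
  set β := 2 / p with hβ
  have hα0 : 0 < α := by positivity
  have hβ0 : 0 < β := by positivity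
  set κ := β ^ (2 / (p - 2)) with hκ
  have hκ0 : 0 < κ := by positivity
  have hκα : κ ^ α = β ^ β := by
    rw [hκ, ← Real.rpow_mul hβ0.le]
    congr 1
    rw [hα, hβ]
    field_simp
  have hθ : theta p = α * κ := by
    have e : p / (p - 2) = 2 / (p - 2) + 1 := by field_simp; ring
    have e' : α = 1 - β := by rw [hα, hβ]; field_simp
    rw [theta, e, Real.rpow_add hβ0, Real.rpow_one, e']
    ring
  have hv' : v ≤ t ^ α * u ^ β := by
    have h₁ := Real.rpow_le_rpow (by positivity) h hα0.le
    rw [← Real.rpow_mul hv, Real.mul_rpow ht (by positivity), ← Real.rpow_mul hu] at h₁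
    have e₁ : p / (p - 2) * α = 1 := by rw [hα]; field_simp
    have e₂ : 2 / (p - 2) * α = β := by rw [hα, hβ]; field_simp
    rwa [e₁, e₂, Real.rpow_one] at h₁
  have hy := Real.geom_mean_le_arith_mean2_weighted hα0.le hβ0.le
    (p₁ := κ * t) (p₂ := u * x ^ (p / 2) / β) (by positivity) (by positivity)
    (by rw [hα, hβ]; field_simp; ring)
  have e : (κ * t) ^ α * (u * x ^ (p / 2) / β) ^ β = t ^ α * u ^ β * x := by
    rw [Real.mul_rpow hκ0.le ht, Real.div_rpow (by positivity) hβ0.le,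
      Real.mul_rpow hu (by positivity), ← Real.rpow_mul hx, hκα]
    have : p / 2 * β = 1 := by rw [hβ]; field_simp
    rw [this, Real.rpow_one]
    have : β ^ β ≠ 0 := by positivity
    field_simp
  rw [e] at hy
  calc v * x ≤ t ^ α * u ^ β * x := mul_le_mul_of_nonneg_right hv' hx
    _ ≤ _ := hy
    _ = _ := by rw [hθ]; field_simp

theorem sum_mul_le_theta {p : ℚ} (hp : 2 < p) {ι : Type*} [Fintype ι] {u : ℝ} {v t x : ι → ℝ}
    (hu : 0 ≤ u) (h : ∀ i, (u, v i, t i) ∈ socCone p) (hx : ∀ i, 0 ≤ x i)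
    (hx1 : ∑ i, |x i| ^ ((p : ℝ) / 2) ≤ 1) :
    ∑ i, v i * x i ≤ u + theta p * ∑ i, t i := by
  have hp' : (2 : ℝ) < p := by exact_mod_cast hp
  calc ∑ i, v i * x i ≤ ∑ i, (theta p * t i + u * |x i| ^ ((p : ℝ) / 2)) := by
        refine Finset.sum_le_sum fun i _ => ?_
        obtain ⟨hu, hv, ht, hc⟩ := (mem_socCone_iff hp).1 (h i)
        rw [abs_of_nonneg (hx i)]
        exact mul_le_theta_mul_add hp' hu hv ht (hx i) hc
    _ = theta p * ∑ i, t i + u * ∑ i, |x i| ^ ((p : ℝ) / 2) := by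
        rw [Finset.sum_add_distrib, Finset.mul_sum, Finset.mul_sum]
    _ ≤ _ := by
        have := mul_le_of_le_one_right hu hx1
        linarith

theorem ConicFeasible.frob_le {p : ℚ} (hp : 2 < p) {m n : ℕ} (hm : 0 < m) (hn : 0 < n)
    {A : Matrix (Fin m) (Fin n) ℝ} {u₁ u₂ : ℝ} {v t : Fin m ⊕ Fin n → ℝ}
    (H : ConicFeasible p A u₁ u₂ v t) {X : Matrix (Fin m ⊕ Fin n) (Fin m ⊕ Fin n) ℝ}
    (hX : VFeasible p X) : frob (symBlock A) X ≤ u₁ + u₂ + theta p * ∑ i, t i := by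
  have h := frob_nonneg_of_posSemidef H.psd hX.psd
  rw [frob_sub_left, frob_diagonal, Fintype.sum_sum_type] at h
  have hu₁ := ((mem_socCone_iff hp).1 (H.cone_left ⟨0, hm⟩)).1
  have hu₂ := ((mem_socCone_iff hp).1 (H.cone_right ⟨0, hn⟩)).1
  have h₁ := sum_mul_le_theta hp hu₁ H.cone_left
    (x := fun i => X (Sum.inl i) (Sum.inl i)) (fun i => hX.psd.diag_nonneg) hX.left
  have h₂ := sum_mul_le_theta hp hu₂ H.cone_right
    (x := fun i => X (Sum.inr i) (Sum.inr i)) (fun i => hX.psd.diag_nonneg) hX.right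
  rw [Fintype.sum_sum_type]
  linarith

/-! ### Strong duality -/

/-- For `v ≥ 0`, the minimum of `u + theta p * ∑ t i` over the cone constraints equals the maximum
of `∑ v i * d i` over the unit ball of `ℓ_{p/2}`: both are the norm of `v` with the exponent
`p / (p - 2)` conjugate to `p / 2`. -/
theorem exists_mem_socCone_eq_sum_mul {p : ℚ} (hp : 2 < p) {ι : Type*} [Fintype ι] {v : ι → ℝ}
    (hv : ∀ i, 0 ≤ v i) :
    ∃ (u : ℝ) (t d : ι → ℝ), (∀ i, (u, v i, t i) ∈ socCone p) ∧
      ∑ i, |d i| ^ ((p : ℝ) / 2) ≤ 1 ∧ u + theta p * ∑ i, t i = ∑ i, v i * d i := by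
  have hp' : (2 : ℝ) < p := by exact_mod_cast hp
  have hp0 : (0 : ℝ) < p := by linarith
  have hp2 : (0 : ℝ) < p - 2 := by linarith
  set q : ℝ := (p : ℝ) / (p - 2) with hq
  have hq0 : 0 < q := by positivity
  set S := ∑ i, v i ^ q with hS
  have hS0 : 0 ≤ S := Finset.sum_nonneg fun i _ => Real.rpow_nonneg (hv i) _
  rcases hS0.eq_or_lt with hS0 | hS0
  · have hv0 : ∀ i, v i = 0 := fun i => by
      have := (Finset.sum_eq_zero_iff_of_nonneg
        (fun i _ => Real.rpow_nonneg (hv i) q)).1 (hS.symm.trans hS0.symm) i (Finset.mem_univ i)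
      exact (Real.rpow_eq_zero (hv i) hq0.ne').1 this
    refine ⟨0, 0, 0, fun i => (mem_socCone_iff hp).2 ?_, ?_, ?_⟩
    · simp [hv0, Real.zero_rpow hq0.ne', ← hq]
    · simp [Real.zero_rpow (half_pos hp0).ne']
    · simp
  set r := S ^ (1 / q) with hr
  have hr0 : 0 < r := by positivity
  set w : ι → ℝ := fun i => v i / r with hw
  have hw0 : ∀ i, 0 ≤ w i := fun i => div_nonneg (hv i) hr0.le
  have hvw : ∀ i, v i = r * w i := fun i => by simp only [hw]; field_simp
  have hw1 : ∑ i, w i ^ q = 1 := by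
    have : ∀ i, w i ^ q = v i ^ q / S := fun i => by
      simp only [hw]
      rw [Real.div_rpow (hv i) hr0.le, hr, ← Real.rpow_mul hS0.le, one_div_mul_cancel hq0.ne',
        Real.rpow_one]
    simp_rw [this]
    rw [← Finset.sum_div, ← hS, div_self hS0.ne']
  set e : ℝ := 2 / ((p : ℝ) - 2) with he
  have he0 : 0 < e := by positivity
  have hqe : q = e + 1 := by rw [hq, he]; field_simp; ring
  have hβ : (0 : ℝ) < 2 / p := by positivity
  have hβe : (0 : ℝ) < (2 / p) ^ e := by positivity
  refine ⟨2 / p * r, fun i => r * w i ^ q / (2 / p) ^ e, fun i => w i ^ e, fun i => ?_, ?_, ?_⟩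
  · rw [mem_socCone_iff hp]
    have hwq : 0 ≤ w i ^ q := Real.rpow_nonneg (hw0 i) _
    refine ⟨by positivity, hv i, by positivity, ?_⟩
    rw [← hq, ← he, hvw i, Real.mul_rpow hr0.le (hw0 i), Real.mul_rpow hβ.le hr0.le]
    have : r ^ q = r * r ^ e := by rw [hqe, Real.rpow_add hr0, Real.rpow_one, mul_comm]
    rw [this]
    refine le_of_eq ?_
    field_simp
  · rw [← hw1]
    refine Finset.sum_le_sum fun i _ => le_of_eq ?_
    rw [abs_of_nonneg (Real.rpow_nonneg (hw0 i) _), ← Real.rpow_mul (hw0 i)]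
    congr 1
    rw [he, hq]
    field_simp
  · have h₁ : ∑ i, v i * w i ^ e = r := by
      have : ∀ i, v i * w i ^ e = r * w i ^ q := fun i => by
        rw [hqe, Real.rpow_add_one' (hw0 i) (by positivity), hvw i]
        ring
      simp_rw [this]
      rw [← Finset.mul_sum, hw1, mul_one]
    have h₂ : ∑ i, r * w i ^ q / (2 / (p : ℝ)) ^ e = r / (2 / p) ^ e := by
      rw [← Finset.sum_div, ← Finset.mul_sum, hw1, mul_one]
    have h₃ : theta p = (2 / (p : ℝ)) ^ e * (1 - 2 / p) := by
      rw [theta, ← hq, ← he, hqe, Real.rpow_add_one hβ.ne']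
      ring
    rw [h₁, h₂, h₃]
    field_simp
    ring

theorem convex_sum_abs_rpow_lt_one {E ι : Type*} [AddCommGroup E] [Module ℝ E]
    [TopologicalSpace E] [Fintype ι] {P : ℝ} (hP : 1 ≤ P) (l : ι → E →L[ℝ] ℝ) :
    Convex ℝ {x : E | ∑ i, |l i x| ^ P < 1} := by
  have h : ConvexOn ℝ Set.univ fun x : E => ∑ i, |l i x| ^ P := by
    refine ⟨convex_univ, fun x _ y _ a b ha hb hab => ?_⟩
    simp only [smul_eq_mul, Finset.mul_sum, ← Finset.sum_add_distrib, map_add, map_smul]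
    refine Finset.sum_le_sum fun i _ => ?_
    calc |a * l i x + b * l i y| ^ P ≤ (a * |l i x| + b * |l i y|) ^ P := by
          refine Real.rpow_le_rpow (abs_nonneg _) ((abs_add_le _ _).trans ?_) (by linarith)
          rw [abs_mul, abs_mul, abs_of_nonneg ha, abs_of_nonneg hb]
      _ ≤ _ := (convexOn_rpow hP).2 (Set.mem_Ici.2 (abs_nonneg _)) (Set.mem_Ici.2 (abs_nonneg _))
          ha hb hab
  simpa using h.convex_lt 1

theorem isOpen_sum_abs_rpow_lt_one {E ι : Type*} [AddCommGroup E] [Module ℝ E]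
    [TopologicalSpace E] [Fintype ι] {P : ℝ} (hP : 0 ≤ P) (l : ι → E →L[ℝ] ℝ) :
    IsOpen {x : E | ∑ i, |l i x| ^ P < 1} :=
  isOpen_lt (continuous_finsetSum _ fun i _ =>
    (l i).continuous.abs.rpow_const fun _ => Or.inr hP) continuous_const

/-- The separation step of strong duality: the convex cone of all `(diag X, ⟨B(A), X⟩)` with `X`
positive semidefinite is separated from the open convex set of all `(d, s)` for which `d` is
strictly inside the constraint region and `s > vNorm p A`. The normal of the separating hyperplane
is the dual solution. -/
theorem exists_diagonal_dual {p : ℝ} (hp : 2 < p) {m n : ℕ} (A : Matrix (Fin m) (Fin n) ℝ) :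
    ∃ v : Fin m ⊕ Fin n → ℝ, (diagonal v - symBlock A).PosSemidef ∧
      ∀ d : Fin m ⊕ Fin n → ℝ, ∑ i, |d (Sum.inl i)| ^ (p / 2) < 1 →
        ∑ j, |d (Sum.inr j)| ^ (p / 2) < 1 → ∑ i, v i * d i ≤ vNorm p A := by
  have hp0 : 0 < p := by linarith
  have hP : 1 ≤ p / 2 := by linarith
  have hP0 : 0 < p / 2 := by linarith
  have hM : 0 ≤ vNorm p A := vNorm_nonneg hp0 A
  set M := vNorm p A with hMdef
  let E := (Fin m ⊕ Fin n → ℝ) × ℝ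
  let coord : Fin m ⊕ Fin n → E →L[ℝ] ℝ := fun i =>
    ContinuousLinearMap.proj i ∘L ContinuousLinearMap.fst ℝ (Fin m ⊕ Fin n → ℝ) ℝ
  have memT : ∀ x : E, x ∈ ({x : E | ∑ i : Fin m, |coord (Sum.inl i) x| ^ (p / 2) < 1} ∩
      {x : E | ∑ j : Fin n, |coord (Sum.inr j) x| ^ (p / 2) < 1}) ∩ {x : E | M < x.2} ↔
      (∑ i, |x.1 (Sum.inl i)| ^ (p / 2) < 1 ∧ ∑ j, |x.1 (Sum.inr j)| ^ (p / 2) < 1) ∧ M < x.2 :=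
    fun _ => Iff.rfl
  have hT := ((convex_sum_abs_rpow_lt_one hP fun i : Fin m => coord (Sum.inl i)).inter
    (convex_sum_abs_rpow_lt_one hP fun j : Fin n => coord (Sum.inr j))).inter
    (convex_halfSpace_gt (LinearMap.snd ℝ (Fin m ⊕ Fin n → ℝ) ℝ).isLinear M)
  have hTo := ((isOpen_sum_abs_rpow_lt_one hP0.le fun i : Fin m => coord (Sum.inl i)).inter
    (isOpen_sum_abs_rpow_lt_one hP0.le fun j : Fin n => coord (Sum.inr j))).inter
    (isOpen_lt (continuous_const (y := M)) (continuous_snd (X := Fin m ⊕ Fin n → ℝ)))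
  generalize hTdef : ({x : E | ∑ i : Fin m, |coord (Sum.inl i) x| ^ (p / 2) < 1} ∩
      {x : E | ∑ j : Fin n, |coord (Sum.inr j) x| ^ (p / 2) < 1}) ∩ {x : E | M < x.2} = T at memT
  replace hT : Convex ℝ T := hTdef ▸ hT
  replace hTo : IsOpen T := hTdef ▸ hTo
  clear hTdef
  let C : Set E := {x | ∃ X : Matrix (Fin m ⊕ Fin n) (Fin m ⊕ Fin n) ℝ, X.PosSemidef ∧
    x = (fun i => X i i, frob (symBlock A) X)}
  have hC : Convex ℝ C := by
    rintro _ ⟨X, hX, rfl⟩ _ ⟨Y, hY, rfl⟩ a b ha hb -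
    refine ⟨a • X + b • Y, (hX.smul ha).add (hY.smul hb), ?_⟩
    rw [frob_add_right, frob_smul_right, frob_smul_right]
    rfl
  have hdisj : Disjoint T C := by
    rw [Set.disjoint_left]
    rintro _ hx ⟨X, hX, rfl⟩
    obtain ⟨⟨h₁, h₂⟩, h₃⟩ := (memT _).1 hx
    exact absurd (VFeasible.frob_le_vNorm hp0 A ⟨h₁.le, h₂.le, hX⟩) (not_le.2 h₃)
  obtain ⟨f, c, hfT, hfC⟩ := geometric_hahn_banach_open hT hTo hC hdisj
  have hc : c ≤ 0 := by
    have := hfC 0 ⟨0, PosSemidef.zero, by ext <;> simp [frob]⟩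
    simpa using this
  have hf : ∀ (d : Fin m ⊕ Fin n → ℝ) (s : ℝ),
      f (d, s) = ∑ i, f (Pi.single i 1, 0) * d i + f (0, 1) * s := by
    intro d s
    have h₁ : ((d, s) : E) = ∑ i, d i • ((Pi.single i 1, 0) : E) + s • ((0, 1) : E) := by
      ext i
      · simp [Prod.fst_sum, Finset.sum_apply, Pi.single_apply, -Fintype.sum_sum_type]
      · simp [Prod.snd_sum]
    rw [h₁, map_add, map_sum, map_smul, smul_eq_mul, mul_comm s]
    congr 1
    exact Finset.sum_congr rfl fun i _ => by rw [map_smul, smul_eq_mul, mul_comm]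
  set g : Fin m ⊕ Fin n → ℝ := fun i => f (Pi.single i 1, 0) with hg
  set γ := f (0, 1) with hγ
  -- `f` is bounded below on the cone, hence nonnegative there
  have hpos : ∀ X : Matrix (Fin m ⊕ Fin n) (Fin m ⊕ Fin n) ℝ, X.PosSemidef →
      0 ≤ ∑ i, g i * X i i + γ * frob (symBlock A) X := by
    intro X hX
    by_contra! hneg
    set y := ∑ i, g i * X i i + γ * frob (symBlock A) X with hy
    have hk : 0 ≤ (c - 1) / y := div_nonneg_of_nonpos (by linarith) hneg.le
    have h₁ := hfC _ ⟨_, hX.smul hk, rfl⟩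
    rw [hf, frob_smul_right] at h₁
    have h₂ : ∑ i, g i * (((c - 1) / y) • X) i i + γ * ((c - 1) / y * frob (symBlock A) X) =
        (c - 1) / y * y := by
      rw [hy, mul_add, Finset.mul_sum]
      congr 1
      · exact Finset.sum_congr rfl fun i _ => by simp [Matrix.smul_apply]; ring
      · ring
    rw [h₂, div_mul_cancel₀ _ hneg.ne] at h₁
    linarith
  have hγ0 : γ < 0 := by
    have hmem : ((0, M + 1) : E) ∈ T := by
      rw [memT]
      simp [Real.zero_rpow hP0.ne']
    have h := hfT _ hmem
    rw [hf] at h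
    simp only [Pi.zero_apply, mul_zero, Finset.sum_const_zero, zero_add] at h
    by_contra! hneg
    have := mul_nonneg hneg (by linarith : 0 ≤ M + 1)
    linarith
  refine ⟨fun i => g i / (-γ), PosSemidef.of_dotProduct_mulVec_nonneg ?_ fun x => ?_, ?_⟩
  · exact (isHermitian_diagonal _).sub (symBlock_isHermitian A)
  · rw [star_trivial, ← frob_vecMulVec_self, frob_sub_left, frob_diagonal]
    have h := hpos _ (posSemidef_vecMulVec_self x)
    have e : ∑ i, g i / -γ * vecMulVec x x i i = (∑ i, g i * vecMulVec x x i i) / -γ := by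
      rw [Finset.sum_div]
      exact Finset.sum_congr rfl fun i _ => by ring
    rw [e, sub_nonneg, le_div_iff₀ (by linarith)]
    linarith
  · intro d h₁ h₂
    refine le_of_forall_gt_imp_ge_of_dense fun s hs => ?_
    have h := hfT (d, s) ((memT _).2 ⟨⟨h₁, h₂⟩, hs⟩)
    rw [hf] at h
    have e : ∑ i, g i / -γ * d i = (∑ i, g i * d i) / -γ := by
      rw [Finset.sum_div]
      exact Finset.sum_congr rfl fun i _ => by ring
    rw [e, div_le_iff₀ (by linarith)]
    linarith

theorem sum_abs_mul_rpow_lt_one {ι : Type*} [Fintype ι] {P : ℝ} (hP : 0 < P) {d : ι → ℝ}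
    (hd : ∑ i, |d i| ^ P ≤ 1) {c : ℝ} (hc0 : 0 ≤ c) (hc1 : c < 1) :
    ∑ i, |c * d i| ^ P < 1 := by
  have : ∀ i, |c * d i| ^ P = c ^ P * |d i| ^ P := fun i => by
    rw [abs_mul, abs_of_nonneg hc0, Real.mul_rpow hc0 (abs_nonneg _)]
  simp_rw [this]
  rw [← Finset.mul_sum]
  exact (mul_le_of_le_one_right (Real.rpow_nonneg hc0 _) hd).trans_lt
    (Real.rpow_lt_one hc0 hc1 hP)

theorem exists_conicFeasible_le {p : ℚ} (hp : 2 < p) {m n : ℕ} (A : Matrix (Fin m) (Fin n) ℝ) :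
    ∃ (u₁ u₂ : ℝ) (v t : Fin m ⊕ Fin n → ℝ),
      ConicFeasible p A u₁ u₂ v t ∧ u₁ + u₂ + theta p * ∑ i, t i ≤ vNorm p A := by
  have hp' : (2 : ℝ) < p := by exact_mod_cast hp
  obtain ⟨v, hpsd, hv⟩ := exists_diagonal_dual hp' A
  have hv0 : ∀ i, 0 ≤ v i := by
    intro i
    have h := hpsd.diag_nonneg (i := i)
    have : symBlock A i i = 0 := by rcases i with i | i <;> simp [symBlock]
    simpa [this] using h
  obtain ⟨u₁, t₁, d₁, hcone₁, hd₁, he₁⟩ :=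
    exists_mem_socCone_eq_sum_mul hp (v := fun i : Fin m => v (Sum.inl i)) fun i => hv0 _
  obtain ⟨u₂, t₂, d₂, hcone₂, hd₂, he₂⟩ :=
    exists_mem_socCone_eq_sum_mul hp (v := fun j : Fin n => v (Sum.inr j)) fun j => hv0 _
  refine ⟨u₁, u₂, v, Sum.elim t₁ t₂, ⟨hcone₁, hcone₂, hpsd⟩, ?_⟩
  rw [Fintype.sum_sum_type]
  simp only [Sum.elim_inl, Sum.elim_inr]
  set r := u₁ + u₂ + theta p * (∑ i, t₁ i + ∑ j, t₂ j) with hr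
  have hr' : r = ∑ i, v (Sum.inl i) * d₁ i + ∑ j, v (Sum.inr j) * d₂ j := by
    rw [← he₁, ← he₂, hr]
    ring
  have hM := vNorm_nonneg (p := p) (by linarith) A
  -- `d₁`, `d₂` may lie on the boundary of the constraint region, so scale them by some `c < 1`
  by_contra! hlt
  have hr0 : 0 < r := hM.trans_lt hlt
  obtain ⟨c, hc, hc1⟩ := exists_between ((div_lt_one hr0).2 hlt)
  have hc0 : 0 ≤ c := (div_nonneg hM hr0.le).trans hc.le
  have h := hv (Sum.elim (fun i => c * d₁ i) (fun j => c * d₂ j))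
    (sum_abs_mul_rpow_lt_one (by linarith) hd₁ hc0 hc1)
    (sum_abs_mul_rpow_lt_one (by linarith) hd₂ hc0 hc1)
  rw [Fintype.sum_sum_type] at h
  simp only [Sum.elim_inl, Sum.elim_inr, mul_left_comm _ c] at h
  rw [← Finset.mul_sum, ← Finset.mul_sum, ← mul_add, ← hr'] at h
  rw [div_lt_iff₀ hr0] at hc
  linarith

theorem isLeast_vProgramValues {p : ℚ} (hp : 2 < p) {m n : ℕ} (hm : 0 < m) (hn : 0 < n)
    (A : Matrix (Fin m) (Fin n) ℝ) : IsLeast (vProgramValues p A) (vNorm p A) := by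
  have hp0 : (0 : ℝ) < p := by exact_mod_cast (by linarith : (0 : ℚ) < p)
  have hle : ∀ {u₁ u₂ : ℝ} {v t : Fin m ⊕ Fin n → ℝ}, ConicFeasible p A u₁ u₂ v t →
      vNorm p A ≤ u₁ + u₂ + theta p * ∑ i, t i :=
    fun H => vNorm_le hp0 fun X hX => H.frob_le hp hm hn hX
  constructor
  · obtain ⟨u₁, u₂, v, t, H, h⟩ := exists_conicFeasible_le hp A
    exact ⟨u₁, u₂, v, t, H, (hle H).antisymm h⟩
  · rintro _ ⟨u₁, u₂, v, t, H, rfl⟩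
    exact hle H

/-! ### The dual norm -/

theorem mem_uProgramFeasible_iff {p : ℚ} (hp : 2 < p) {m n : ℕ} (hm : 0 < m) (hn : 0 < n)
    {Z : Matrix (Fin m) (Fin n) ℝ} : Z ∈ uProgramFeasible p m n ↔ vNorm p Z ≤ 1 := by
  constructor
  · rintro ⟨u₁, u₂, v, t, h, H⟩
    exact ((isLeast_vProgramValues hp hm hn Z).2 ⟨u₁, u₂, v, t, H, rfl⟩).trans h
  · intro h
    obtain ⟨u₁, u₂, v, t, H, he⟩ := (isLeast_vProgramValues hp hm hn Z).1
    exact ⟨u₁, u₂, v, t, he ▸ h, H⟩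

/-- A pair of `ℓ_p`-bounded vectors gives a feasible matrix of rank one. -/
theorem vFeasible_vecMulVec_elim {p : ℝ} {m n : ℕ} {x : Fin m → ℝ} {y : Fin n → ℝ}
    (hx : ∑ i, |x i| ^ p ≤ 1) (hy : ∑ j, |y j| ^ p ≤ 1) :
    VFeasible p (vecMulVec (Sum.elim x y) (Sum.elim x y)) := by
  have key : ∀ a : ℝ, (a * a) ^ (p / 2) = |a| ^ p := fun a => by
    rw [← abs_mul_abs_self, ← sq, ← Real.rpow_natCast, ← Real.rpow_mul (abs_nonneg _)]
    congr 1
    push_cast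
    ring
  refine ⟨?_, ?_, posSemidef_vecMulVec_self _⟩
  · simpa [vecMulVec_apply, key] using hx
  · simpa [vecMulVec_apply, key] using hy

theorem frob_symBlock_vecMulVec_elim {m n : ℕ} (A : Matrix (Fin m) (Fin n) ℝ) (x : Fin m → ℝ)
    (y : Fin n → ℝ) :
    frob (symBlock A) (vecMulVec (Sum.elim x y) (Sum.elim x y)) = frob A (vecMulVec x y) := by
  rw [frob_symBlock A (posSemidef_vecMulVec_self _)]
  simp [frob, vecMulVec_apply]

theorem frob_vecMulVec_le_vNorm {p : ℝ} (hp : 0 < p) {m n : ℕ} (A : Matrix (Fin m) (Fin n) ℝ)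
    {x : Fin m → ℝ} {y : Fin n → ℝ} (hx : ∑ i, |x i| ^ p ≤ 1) (hy : ∑ j, |y j| ^ p ≤ 1) :
    frob A (vecMulVec x y) ≤ vNorm p A := by
  rw [← frob_symBlock_vecMulVec_elim]
  exact (vFeasible_vecMulVec_elim hx hy).frob_le_vNorm hp A

theorem sum_abs_single_rpow {ι : Type*} [Fintype ι] [DecidableEq ι] {p : ℝ} (hp : 0 < p) (i : ι)
    {a : ℝ} (ha : |a| = 1) : ∑ j, |(Pi.single i a : ι → ℝ) j| ^ p = 1 := by
  rw [Finset.sum_eq_single i]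
  · simp [ha]
  · intro j _ hj
    simp [hj, Real.zero_rpow hp.ne']
  · simp

theorem frob_vecMulVec_single {m n : ℕ} (A : Matrix (Fin m) (Fin n) ℝ) (i : Fin m) (j : Fin n)
    (a b : ℝ) : frob A (vecMulVec (Pi.single i a) (Pi.single j b)) = a * b * A i j := by
  simp [frob, vecMulVec_apply, Pi.single_apply]
  ring

theorem abs_apply_le_vNorm {p : ℝ} (hp : 0 < p) {m n : ℕ} (A : Matrix (Fin m) (Fin n) ℝ)
    (i : Fin m) (j : Fin n) : |A i j| ≤ vNorm p A := by
  have h : ∀ a : ℝ, |a| = 1 → a * A i j ≤ vNorm p A := fun a ha => by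
    have := frob_vecMulVec_le_vNorm hp A (x := Pi.single i a) (y := Pi.single j 1)
      (sum_abs_single_rpow hp i ha).le (sum_abs_single_rpow hp j abs_one).le
    rwa [frob_vecMulVec_single, mul_one] at this
  rw [abs_le]
  constructor
  · have := h (-1) (by simp)
    linarith
  · simpa using h 1 (by simp)

theorem isCompact_vNorm_le_one {p : ℝ} (hp : 0 < p) (m n : ℕ) :
    IsCompact {Z : Matrix (Fin m) (Fin n) ℝ | vNorm p Z ≤ 1} := by
  have hbox : IsCompact {Z : Matrix (Fin m) (Fin n) ℝ | ∀ i j, Z i j ∈ Set.Icc (-1 : ℝ) 1} := by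
    have := isCompact_univ_pi (fun _ : Fin m => isCompact_univ_pi fun _ : Fin n =>
      isCompact_Icc (a := (-1 : ℝ)) (b := 1))
    have e : {Z : Matrix (Fin m) (Fin n) ℝ | ∀ i j, Z i j ∈ Set.Icc (-1 : ℝ) 1} =
        Set.univ.pi fun _ : Fin m => Set.univ.pi fun _ : Fin n => Set.Icc (-1 : ℝ) 1 :=
      Set.ext fun Z => ⟨fun h i _ j _ => h i j, fun h i j => h i trivial j trivial⟩
    rw [e]
    exact this
  have hclosed : IsClosed {Z : Matrix (Fin m) (Fin n) ℝ | vNorm p Z ≤ 1} := by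
    have e : {Z : Matrix (Fin m) (Fin n) ℝ | vNorm p Z ≤ 1} =
        ⋂ (X) (_ : VFeasible p X), {Z | frob (symBlock Z) X ≤ 1} := by
      ext Z
      rw [Set.mem_iInter₂]
      exact ⟨fun h X hX => (hX.frob_le_vNorm hp Z).trans h, fun h => vNorm_le hp h⟩
    rw [e]
    refine isClosed_biInter fun X hX => isClosed_le ?_ continuous_const
    simp_rw [fun Z : Matrix (Fin m) (Fin n) ℝ => frob_symBlock Z hX.psd]
    fun_prop
  exact hbox.of_isClosed_subset hclosed fun Z hZ i j =>
    abs_le.1 ((abs_apply_le_vNorm hp Z i j).trans hZ)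

theorem isGreatest_uNorm {p : ℝ} (hp : 0 < p) {m n : ℕ} (A : Matrix (Fin m) (Fin n) ℝ) :
    IsGreatest (frob A '' {Z : Matrix (Fin m) (Fin n) ℝ | vNorm p Z ≤ 1}) (uNorm p A) := by
  have hne : {Z : Matrix (Fin m) (Fin n) ℝ | vNorm p Z ≤ 1}.Nonempty := by
    refine ⟨0, vNorm_le hp fun X hX => ?_⟩
    simp [frob_symBlock _ hX.psd]
  have h := ((isCompact_vNorm_le_one hp m n).image (continuous_frob_right A)).isGreatest_sSup
    (hne.image _)
  have e : uNorm p A = sSup (frob A '' {Z : Matrix (Fin m) (Fin n) ℝ | vNorm p Z ≤ 1}) :=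
    congrArg sSup <| Set.ext fun s =>
      ⟨fun ⟨Z, hZ, hs⟩ => ⟨Z, hZ, hs.symm⟩, fun ⟨Z, hZ, hs⟩ => ⟨Z, hZ, hs.symm⟩⟩
  rwa [e]

theorem frob_le_uNorm {p : ℝ} (hp : 0 < p) {m n : ℕ} {A Z : Matrix (Fin m) (Fin n) ℝ}
    (hZ : vNorm p Z ≤ 1) : frob A Z ≤ uNorm p A :=
  (isGreatest_uNorm hp A).2 ⟨Z, hZ, rfl⟩

/-! ### The Grothendieck inequality -/

/-- Sign vectors on a finite probability space: every linear combination `∑ ε k * a k` of the signs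
has second moment `∑ a k ^ 2` and fourth moment at most `3 * (∑ a k ^ 2) ^ 2`. -/
theorem exists_rademacher (d : ℕ) :
    ∃ (Ω : Type) (_ : Fintype Ω) (_ : Nonempty Ω) (ε : Ω → Fin d → ℝ), ∀ a : Fin d → ℝ,
      ∑ ω, (∑ k, ε ω k * a k) ^ 2 = Fintype.card Ω * ∑ k, a k ^ 2 ∧
      ∑ ω, (∑ k, ε ω k * a k) ^ 4 ≤ Fintype.card Ω * (3 * (∑ k, a k ^ 2) ^ 2) := by
  induction d with
  | zero => exact ⟨Unit, inferInstance, inferInstance, fun _ _ => 0, fun a => by simp⟩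
  | succ d ih =>
    obtain ⟨Ω, _, _, ε, h⟩ := ih
    refine ⟨Ω × Bool, inferInstance, inferInstance,
      fun ω => Fin.cons (if ω.2 then 1 else -1) (ε ω.1), fun a => ?_⟩
    set X : Ω → ℝ := fun ω => ∑ k, ε ω k * a k.succ with hX
    set s := ∑ k : Fin d, a k.succ ^ 2 with hs
    have h₂ : ∑ ω, X ω ^ 2 = Fintype.card Ω * s := (h fun k => a k.succ).1
    have h₄ : ∑ ω, X ω ^ 4 ≤ Fintype.card Ω * (3 * s ^ 2) := (h fun k => a k.succ).2
    have e : ∀ (ω : Ω) (b : Bool), ∑ k, (Fin.cons (if b then 1 else -1) (ε ω) : Fin (d + 1) → ℝ) k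
        * a k = (if b then 1 else -1) * a 0 + X ω := fun ω b => by
      rw [Fin.sum_univ_succ]
      simp [hX]
    simp only [Fintype.sum_prod_type, e, Fintype.sum_bool, Fintype.card_prod, Fintype.card_bool,
      if_true, Bool.false_eq_true, if_false, Fin.sum_univ_succ, ← hs]
    push_cast
    constructor
    · have : ∀ ω, (1 * a 0 + X ω) ^ 2 + (-1 * a 0 + X ω) ^ 2 = 2 * a 0 ^ 2 + 2 * X ω ^ 2 :=
        fun ω => by ring
      simp_rw [this]
      rw [Finset.sum_add_distrib, Finset.sum_const, Finset.card_univ, nsmul_eq_mul,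
        ← Finset.mul_sum, h₂]
      ring
    · have : ∀ ω, (1 * a 0 + X ω) ^ 4 + (-1 * a 0 + X ω) ^ 4 =
          2 * a 0 ^ 4 + (12 * a 0 ^ 2 * X ω ^ 2 + 2 * X ω ^ 4) := fun ω => by ring
      simp_rw [this]
      rw [Finset.sum_add_distrib, Finset.sum_add_distrib, Finset.sum_const, Finset.card_univ,
        nsmul_eq_mul, ← Finset.mul_sum, ← Finset.mul_sum, h₂]
      have hN : (0 : ℝ) ≤ Fintype.card Ω * a 0 ^ 4 := by positivity
      nlinarith

/-- A bound for the bilinear form over Euclidean unit balls, restated for square-summable functions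
on any finite index type. -/
theorem abs_sum_mul_sum_le {m n : ℕ} {A : Matrix (Fin m) (Fin n) ℝ} {K : ℝ}
    (hK : ∀ (d : ℕ) (x : Fin m → EuclideanSpace ℝ (Fin d)) (y : Fin n → EuclideanSpace ℝ (Fin d)),
      (∀ i, ‖x i‖ ≤ 1) → (∀ j, ‖y j‖ ≤ 1) → |∑ i, ∑ j, A i j * inner ℝ (x i) (y j)| ≤ K)
    {Ω : Type*} [Fintype Ω] {f : Fin m → Ω → ℝ} {g : Fin n → Ω → ℝ} {α β : ℝ}
    (hα : 0 < α) (hβ : 0 < β) (hf : ∀ i, ∑ ω, f i ω ^ 2 ≤ α ^ 2)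
    (hg : ∀ j, ∑ ω, g j ω ^ 2 ≤ β ^ 2) :
    |∑ i, ∑ j, A i j * ∑ ω, f i ω * g j ω| ≤ α * β * K := by
  let e := Fintype.equivFin Ω
  have hnorm : ∀ {φ : Ω → ℝ} {γ : ℝ}, 0 < γ → ∑ ω, φ ω ^ 2 ≤ γ ^ 2 →
      ‖(WithLp.toLp 2 fun k => φ (e.symm k) / γ : EuclideanSpace ℝ (Fin (Fintype.card Ω)))‖ ≤ 1 := by
    intro φ γ hγ h
    rw [EuclideanSpace.norm_eq]
    rw [Real.sqrt_le_one]
    simp only [Real.norm_eq_abs, sq_abs, div_pow]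
    rw [← Finset.sum_div, e.symm.sum_comp fun ω => φ ω ^ 2]
    exact (div_le_one (by positivity)).2 h
  have h := hK _ _ _ (fun i => hnorm hα (hf i)) (fun j => hnorm hβ (hg j))
  have hin : ∀ i j, inner ℝ
      (WithLp.toLp 2 fun k => f i (e.symm k) / α : EuclideanSpace ℝ (Fin (Fintype.card Ω)))
      (WithLp.toLp 2 fun k => g j (e.symm k) / β) = (∑ ω, f i ω * g j ω) / (α * β) := fun i j => by
    rw [← e.symm.sum_comp fun ω => f i ω * g j ω, Finset.sum_div, PiLp.inner_apply]
    refine Finset.sum_congr rfl fun k _ => ?_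
    simp only [RCLike.inner_apply, conj_trivial]
    field_simp
  simp only [hin, mul_div_assoc', ← Finset.sum_div] at h
  rwa [abs_div, abs_of_pos (mul_pos hα hβ), div_le_iff₀ (mul_pos hα hβ), mul_comm K] at h

/-- A crude bound depending on the matrix; it makes the optimal bound for each matrix finite. -/
theorem abs_sum_mul_inner_le {m n d : ℕ} (A : Matrix (Fin m) (Fin n) ℝ)
    {x : Fin m → EuclideanSpace ℝ (Fin d)} {y : Fin n → EuclideanSpace ℝ (Fin d)}
    (hx : ∀ i, ‖x i‖ ≤ 1) (hy : ∀ j, ‖y j‖ ≤ 1) :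
    |∑ i, ∑ j, A i j * inner ℝ (x i) (y j)| ≤ ∑ i, ∑ j, |A i j| := by
  refine (Finset.abs_sum_le_sum_abs _ _).trans (Finset.sum_le_sum fun i _ => ?_)
  refine (Finset.abs_sum_le_sum_abs _ _).trans (Finset.sum_le_sum fun j _ => ?_)
  rw [abs_mul]
  refine mul_le_of_le_one_right (abs_nonneg _) ((abs_real_inner_le_norm _ _).trans ?_)
  exact mul_le_one₀ (hx i) (norm_nonneg _) (hy j)

theorem abs_sum_mul_le_sq {m n : ℕ} {A : Matrix (Fin m) (Fin n) ℝ}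
    (hA : ∀ (s : Fin m → ℝ) (t : Fin n → ℝ), (∀ i, |s i| ≤ 1) → (∀ j, |t j| ≤ 1) →
      |∑ i, ∑ j, A i j * (s i * t j)| ≤ 1)
    {M : ℝ} (hM : 0 < M) {s : Fin m → ℝ} {t : Fin n → ℝ} (hs : ∀ i, |s i| ≤ M)
    (ht : ∀ j, |t j| ≤ M) : |∑ i, ∑ j, A i j * (s i * t j)| ≤ M ^ 2 := by
  have h := hA (fun i => s i / M) (fun j => t j / M)
    (fun i => by rw [abs_div, abs_of_pos hM]; exact (div_le_one hM).2 (hs i))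
    (fun j => by rw [abs_div, abs_of_pos hM]; exact (div_le_one hM).2 (ht j))
  have e : ∀ i j, A i j * (s i / M * (t j / M)) = A i j * (s i * t j) / M ^ 2 := fun i j => by
    field_simp
  simp only [e, ← Finset.sum_div] at h
  rwa [abs_div, abs_of_pos (pow_pos hM 2), div_le_one (pow_pos hM 2)] at h

/-- The self-improving step of the Grothendieck inequality: a bound `K` on the form over all
Euclidean unit balls improves to `49 + K / 2`. Each vector is replaced by the corresponding
combination of random signs, which is then truncated at height `7`. The truncated parts contribute
at most `7 ^ 2`, and the remainders have `L²`-norm at most `√(3 / 49) ≤ 1 / 4`. -/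
theorem abs_sum_mul_inner_le_of_bound {m n : ℕ} {A : Matrix (Fin m) (Fin n) ℝ}
    (hA : ∀ (s : Fin m → ℝ) (t : Fin n → ℝ), (∀ i, |s i| ≤ 1) → (∀ j, |t j| ≤ 1) →
      |∑ i, ∑ j, A i j * (s i * t j)| ≤ 1) {K : ℝ}
    (hK : ∀ (d : ℕ) (x : Fin m → EuclideanSpace ℝ (Fin d)) (y : Fin n → EuclideanSpace ℝ (Fin d)),
      (∀ i, ‖x i‖ ≤ 1) → (∀ j, ‖y j‖ ≤ 1) → |∑ i, ∑ j, A i j * inner ℝ (x i) (y j)| ≤ K)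
    {d : ℕ} {x : Fin m → EuclideanSpace ℝ (Fin d)} {y : Fin n → EuclideanSpace ℝ (Fin d)}
    (hx : ∀ i, ‖x i‖ ≤ 1) (hy : ∀ j, ‖y j‖ ≤ 1) :
    |∑ i, ∑ j, A i j * inner ℝ (x i) (y j)| ≤ 49 + K / 2 := by
  obtain ⟨Ω, _, _, ε, hε⟩ := exists_rademacher d
  set N : ℝ := ((Fintype.card Ω : ℕ) : ℝ) with hN
  have hN0 : 0 < N := by rw [hN]; exact_mod_cast Fintype.card_pos
  let G : EuclideanSpace ℝ (Fin d) → Ω → ℝ := fun a ω => ∑ k, ε ω k * a k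
  let T : EuclideanSpace ℝ (Fin d) → Ω → ℝ := fun a ω => if |G a ω| ≤ 7 then G a ω else 0
  let R : EuclideanSpace ℝ (Fin d) → Ω → ℝ := fun a ω => if |G a ω| ≤ 7 then 0 else G a ω
  have hTR : ∀ a ω, G a ω = T a ω + R a ω := fun a ω => by
    simp only [T, R]; split_ifs <;> simp
  have hT7 : ∀ a ω, |T a ω| ≤ 7 := fun a ω => by
    simp only [T]; split_ifs with h <;> simp [h]
  have hnorm : ∀ a : EuclideanSpace ℝ (Fin d), ∑ k, a k ^ 2 = ‖a‖ ^ 2 := fun a => by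
    rw [EuclideanSpace.norm_sq_eq]; simp
  have hG2 : ∀ a, ∑ ω, G a ω ^ 2 = N * ‖a‖ ^ 2 := fun a => by
    rw [← hnorm]; exact (hε a).1
  have hG4 : ∀ a, ∑ ω, G a ω ^ 4 ≤ N * (3 * (‖a‖ ^ 2) ^ 2) := fun a => by
    rw [← hnorm]; exact (hε a).2
  have hinner : ∀ a b, ∑ ω, G a ω * G b ω = N * inner ℝ a b := fun a b => by
    have hadd : ∀ ω, G (a + b) ω = G a ω + G b ω := fun ω => by
      simp [G, mul_add, Finset.sum_add_distrib]
    have h₁ := hG2 (a + b)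
    simp only [hadd, add_sq, Finset.sum_add_distrib, hG2, norm_add_sq_real, mul_assoc,
      ← Finset.mul_sum] at h₁
    linarith
  have hsN : √N ^ 2 = N := Real.sq_sqrt hN0.le
  have hsN0 : 0 < √N := Real.sqrt_pos.2 hN0
  have hG1 : ∀ a, ‖a‖ ≤ 1 → ∑ ω, G a ω ^ 2 ≤ √N ^ 2 := fun a ha => by
    rw [hG2, hsN]
    exact mul_le_of_le_one_right hN0.le (pow_le_one₀ (norm_nonneg _) ha)
  have hT1 : ∀ a, ‖a‖ ≤ 1 → ∑ ω, T a ω ^ 2 ≤ √N ^ 2 := fun a ha => by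
    refine (Finset.sum_le_sum fun ω _ => ?_).trans (hG1 a ha)
    simp only [T]
    split_ifs
    · exact le_rfl
    · simpa using sq_nonneg _
  have hR1 : ∀ a, ‖a‖ ≤ 1 → ∑ ω, R a ω ^ 2 ≤ (√N / 4) ^ 2 := fun a ha => by
    have h₁ : ∑ ω, R a ω ^ 2 ≤ ∑ ω, G a ω ^ 4 / 49 := by
      refine Finset.sum_le_sum fun ω _ => ?_
      simp only [R]
      split_ifs with h
      · rw [zero_pow two_ne_zero]; positivity
      · have h7 : (7 : ℝ) ^ 2 ≤ G a ω ^ 2 := by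
          rw [← sq_abs (G a ω)]
          exact pow_le_pow_left₀ (by norm_num) (not_le.1 h).le 2
        nlinarith [sq_nonneg (G a ω)]
    have h₂ : (‖a‖ ^ 2) ^ 2 ≤ 1 := pow_le_one₀ (sq_nonneg _) (pow_le_one₀ (norm_nonneg _) ha)
    have h₃ := hG4 a
    rw [← Finset.sum_div] at h₁
    rw [div_pow, hsN]
    nlinarith
  -- the decomposition `G x * G y = T x * T y + T x * R y + R x * G y`
  have hsplit : N * ∑ i, ∑ j, A i j * inner ℝ (x i) (y j) =
      ∑ ω, (∑ i, ∑ j, A i j * (T (x i) ω * T (y j) ω)) +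
        ∑ i, ∑ j, A i j * ∑ ω, T (x i) ω * R (y j) ω +
        ∑ i, ∑ j, A i j * ∑ ω, R (x i) ω * G (y j) ω := by
    rw [Finset.sum_comm (s := (Finset.univ : Finset Ω))]
    simp only [Finset.sum_comm (s := (Finset.univ : Finset Ω)), ← Finset.mul_sum,
      ← Finset.sum_add_distrib]
    rw [Finset.mul_sum]
    refine Finset.sum_congr rfl fun i _ => ?_
    rw [Finset.mul_sum]
    refine Finset.sum_congr rfl fun j _ => ?_
    rw [mul_left_comm, ← hinner, ← mul_add, ← mul_add, ← Finset.sum_add_distrib,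
      ← Finset.sum_add_distrib]
    refine congrArg _ (Finset.sum_congr rfl fun ω _ => ?_)
    rw [hTR (x i), hTR (y j)]
    ring
  have hb₁ : |∑ ω, ∑ i, ∑ j, A i j * (T (x i) ω * T (y j) ω)| ≤ N * 49 := by
    refine (Finset.abs_sum_le_sum_abs _ _).trans ?_
    calc _ ≤ ∑ _ω : Ω, (49 : ℝ) := by
          refine Finset.sum_le_sum fun ω _ => ?_
          have := abs_sum_mul_le_sq hA (M := 7) (by norm_num) (fun i => hT7 (x i) ω)
            (fun j => hT7 (y j) ω)
          norm_num at this
          exact this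
      _ = N * 49 := by simp [hN]
  have hb₂ := abs_sum_mul_sum_le hK hsN0 (by positivity : 0 < √N / 4)
    (fun i => hT1 _ (hx i)) (fun j => hR1 _ (hy j))
  have hb₃ := abs_sum_mul_sum_le hK (by positivity : 0 < √N / 4) hsN0
    (fun i => hR1 _ (hx i)) (fun j => hG1 _ (hy j))
  have e₂ : √N * (√N / 4) * K = N * (K / 4) := by linear_combination K / 4 * hsN
  have e₃ : √N / 4 * √N * K = N * (K / 4) := by linear_combination K / 4 * hsN
  rw [e₂] at hb₂
  rw [e₃] at hb₃
  have hfin : N * |∑ i, ∑ j, A i j * inner ℝ (x i) (y j)| ≤ N * (49 + K / 2) := by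
    rw [← abs_of_pos hN0, ← abs_mul, abs_of_pos hN0, hsplit]
    refine (abs_add_three _ _ _).trans ?_
    linarith
  exact le_of_mul_le_mul_left hfin hN0

theorem isGrothendieckBound_ninetyEight : IsGrothendieckBound 98 := by
  intro m n d A hA x y hx hy
  set V : Set ℝ := {s | ∃ (d : ℕ) (x : Fin m → EuclideanSpace ℝ (Fin d))
    (y : Fin n → EuclideanSpace ℝ (Fin d)), (∀ i, ‖x i‖ ≤ 1) ∧ (∀ j, ‖y j‖ ≤ 1) ∧
      s = |∑ i, ∑ j, A i j * inner ℝ (x i) (y j)|} with hV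
  have hbdd : BddAbove V := by
    refine ⟨∑ i, ∑ j, |A i j|, ?_⟩
    rintro _ ⟨d, x, y, hx, hy, rfl⟩
    exact abs_sum_mul_inner_le A hx hy
  have hK : ∀ (d : ℕ) (x : Fin m → EuclideanSpace ℝ (Fin d))
      (y : Fin n → EuclideanSpace ℝ (Fin d)), (∀ i, ‖x i‖ ≤ 1) → (∀ j, ‖y j‖ ≤ 1) →
      |∑ i, ∑ j, A i j * inner ℝ (x i) (y j)| ≤ sSup V :=
    fun d x y hx hy => le_csSup hbdd ⟨d, x, y, hx, hy, rfl⟩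
  -- the supremum is finite, so the self-improving step bounds it
  have hsup : sSup V ≤ 49 + sSup V / 2 := by
    refine csSup_le ⟨_, d, x, y, hx, hy, rfl⟩ ?_
    rintro _ ⟨d, x, y, hx, hy, rfl⟩
    exact abs_sum_mul_inner_le_of_bound hA hK hx hy
  have := hK d x y hx hy
  linarith

theorem IsGrothendieckBound.one_le {K : ℝ} (hK : IsGrothendieckBound K) : 1 ≤ K := by
  have h := hK 1 1 1 1 (fun s t hs ht => by
      simpa [abs_mul] using mul_le_one₀ (hs 0) (abs_nonneg _) (ht 0))
    (fun _ => EuclideanSpace.single 0 1) (fun _ => EuclideanSpace.single 0 1)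
    (fun _ => by simp) (fun _ => by simp)
  simpa using h

theorem one_le_grothendieckConstant : 1 ≤ grothendieckConstant :=
  le_csInf ⟨98, isGrothendieckBound_ninetyEight⟩ fun _ hK => hK.one_le

theorem isGrothendieckBound_grothendieckConstant : IsGrothendieckBound grothendieckConstant :=
  fun m n d A hA x y hx hy =>
    le_csInf ⟨98, isGrothendieckBound_ninetyEight⟩ fun _ hK => hK m n d A hA x y hx hy

/-! ### Comparison of the spectral norm with its relaxation -/

theorem ellNorm_eq_one_iff {p : ℝ} (hp : 0 < p) {ι : Type*} [Fintype ι] {x : ι → ℝ} :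
    ellNorm p x = 1 ↔ ∑ i, |x i| ^ p = 1 := by
  have h : 0 ≤ ∑ i, |x i| ^ p := Finset.sum_nonneg fun i _ => Real.rpow_nonneg (abs_nonneg _) _
  unfold ellNorm
  rw [← Real.rpow_left_inj h zero_le_one (one_div_ne_zero hp.ne'), Real.one_rpow]

theorem exists_eq_smul_unit {p : ℝ} (hp : 0 < p) {ι : Type*} [Fintype ι] [Nonempty ι] {x : ι → ℝ}
    (hx : ∑ i, |x i| ^ p ≤ 1) :
    ∃ (r : ℝ) (e : ι → ℝ), 0 ≤ r ∧ r ≤ 1 ∧ ∑ i, |e i| ^ p = 1 ∧ x = r • e := by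
  classical
  set s := ∑ i, |x i| ^ p with hs
  have hs0 : 0 ≤ s := Finset.sum_nonneg fun i _ => Real.rpow_nonneg (abs_nonneg _) _
  rcases hs0.eq_or_lt with h | h
  · obtain ⟨i₀⟩ := ‹Nonempty ι›
    refine ⟨0, Pi.single i₀ 1, le_rfl, zero_le_one, sum_abs_single_rpow hp i₀ abs_one, ?_⟩
    ext i
    have := (Finset.sum_eq_zero_iff_of_nonneg
      (fun i _ => Real.rpow_nonneg (abs_nonneg (x i)) p)).1 (hs.symm.trans h.symm) i
      (Finset.mem_univ i)
    simpa using (Real.rpow_eq_zero (abs_nonneg _) hp.ne').1 this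
  · have hr : 0 < s ^ (1 / p) := by positivity
    refine ⟨s ^ (1 / p), (s ^ (1 / p))⁻¹ • x, hr.le, Real.rpow_le_one hs0 hx (by positivity), ?_, ?_⟩
    · have : ∀ i, |((s ^ (1 / p))⁻¹ • x) i| ^ p = |x i| ^ p / s := fun i => by
        rw [Pi.smul_apply, smul_eq_mul, abs_mul, abs_of_pos (inv_pos.2 hr),
          Real.mul_rpow (inv_pos.2 hr).le (abs_nonneg _), Real.inv_rpow hr.le,
          ← Real.rpow_mul hs0, one_div_mul_cancel hp.ne', Real.rpow_one]
        field_simp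
      simp_rw [this]
      rw [← Finset.sum_div, ← hs, div_self h.ne']
    · rw [smul_smul, mul_inv_cancel₀ hr.ne', one_smul]

theorem frob_vecMulVec_neg_left {ι κ : Type*} [Fintype ι] [Fintype κ] (A : Matrix ι κ ℝ)
    (x : ι → ℝ) (y : κ → ℝ) : frob A (vecMulVec (-x) y) = -frob A (vecMulVec x y) := by
  rw [neg_vecMulVec, ← neg_one_smul ℝ, frob_smul_right, neg_one_mul]

/-- A bound for the bilinear form on the `ℓ_p` unit spheres extends to the unit balls. -/
theorem abs_frob_vecMulVec_le_one {p : ℝ} (hp : 0 < p) {m n : ℕ} (hm : 0 < m) (hn : 0 < n)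
    {Z : Matrix (Fin m) (Fin n) ℝ}
    (hZ : ∀ (x : Fin m → ℝ) (y : Fin n → ℝ), ∑ i, |x i| ^ p = 1 → ∑ j, |y j| ^ p = 1 →
      frob Z (vecMulVec x y) ≤ 1) {x : Fin m → ℝ} {y : Fin n → ℝ}
    (hx : ∑ i, |x i| ^ p ≤ 1) (hy : ∑ j, |y j| ^ p ≤ 1) : |frob Z (vecMulVec x y)| ≤ 1 := by
  have : Nonempty (Fin m) := ⟨⟨0, hm⟩⟩
  have : Nonempty (Fin n) := ⟨⟨0, hn⟩⟩
  obtain ⟨r, e, hr0, hr1, he, rfl⟩ := exists_eq_smul_unit hp hx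
  obtain ⟨s, f, hs0, hs1, hf, rfl⟩ := exists_eq_smul_unit hp hy
  have h : |frob Z (vecMulVec e f)| ≤ 1 := by
    have h₁ := hZ e f he hf
    have h₂ := hZ (-e) f (by simpa using he) hf
    rw [frob_vecMulVec_neg_left] at h₂
    exact abs_le.2 ⟨by linarith, h₁⟩
  rw [smul_vecMulVec, vecMulVec_smul, frob_smul_right, frob_smul_right, abs_mul, abs_mul,
    abs_of_nonneg hr0, abs_of_nonneg hs0]
  exact mul_le_one₀ hr1 (by positivity) (mul_le_one₀ hs1 (abs_nonneg _) h)

/-- The relaxation exceeds the spectral norm at most by the Grothendieck constant. A feasible `X` is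
a Gram matrix; the lengths `√(X i i)` of its vectors are `ℓ_p`-bounded, so they can be absorbed into
`Z`, and the Grothendieck inequality applies to the normalized vectors. -/
theorem vNorm_le_of_frob_vecMulVec_le {p : ℝ} (hp : 0 < p) {m n : ℕ} (hm : 0 < m) (hn : 0 < n)
    {K : ℝ} (hK : IsGrothendieckBound K) {Z : Matrix (Fin m) (Fin n) ℝ}
    (hZ : ∀ (x : Fin m → ℝ) (y : Fin n → ℝ), ∑ i, |x i| ^ p = 1 → ∑ j, |y j| ^ p = 1 →
      frob Z (vecMulVec x y) ≤ 1) : vNorm p Z ≤ K := by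
  refine vNorm_le hp fun X hX => ?_
  obtain ⟨d, g, hg⟩ := exists_gram_of_posSemidef hX.psd
  set α : Fin m ⊕ Fin n → ℝ := fun a => √(X a a) with hα
  have hα0 : ∀ a, 0 ≤ α a := fun a => Real.sqrt_nonneg _
  have hα2 : ∀ a, α a ^ 2 = X a a := fun a => Real.sq_sqrt hX.psd.diag_nonneg
  have hαp : ∀ a, α a ^ p = |X a a| ^ (p / 2) := fun a => by
    rw [← hα2, abs_of_nonneg (sq_nonneg _), ← Real.rpow_natCast, ← Real.rpow_mul (hα0 a)]
    congr 1
    push_cast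
    ring
  have hgsq : ∀ a, ∑ k, g a k ^ 2 = α a ^ 2 := fun a => by
    rw [hα2, hg]
    simp [sq]
  -- `α a = 0` is harmless: then `g a = 0` as well, and `(α a)⁻¹ = 0`
  have hαg : ∀ a k, α a * ((α a)⁻¹ * g a k) = g a k := fun a k => by
    by_cases h : α a = 0
    · have h₁ := hgsq a
      rw [h, zero_pow two_ne_zero, Finset.sum_eq_zero_iff_of_nonneg fun k _ => sq_nonneg _] at h₁
      rw [h, zero_mul, pow_eq_zero_iff two_ne_zero |>.1 (h₁ k (Finset.mem_univ k))]
    · rw [mul_inv_cancel_left₀ h]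
  let e : Fin m ⊕ Fin n → EuclideanSpace ℝ (Fin d) := fun a => WithLp.toLp 2 fun k => (α a)⁻¹ * g a k
  have he : ∀ a, ‖e a‖ ≤ 1 := fun a => by
    rw [EuclideanSpace.norm_eq, Real.sqrt_le_one]
    simp only [e, Real.norm_eq_abs, sq_abs, mul_pow]
    rw [← Finset.mul_sum, hgsq, ← mul_pow]
    exact pow_le_one₀ (mul_nonneg (inv_nonneg.2 (hα0 a)) (hα0 a)) (inv_mul_le_one)
  have hC : ∀ (s : Fin m → ℝ) (t : Fin n → ℝ), (∀ i, |s i| ≤ 1) → (∀ j, |t j| ≤ 1) →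
      |∑ i, ∑ j, (Z i j * (α (Sum.inl i) * α (Sum.inr j))) * (s i * t j)| ≤ 1 := by
    intro s t hs ht
    have key : ∀ (a : Fin m ⊕ Fin n) (c : ℝ), |c| ≤ 1 → |α a * c| ^ p ≤ |X a a| ^ (p / 2) :=
      fun a c hc => by
        rw [← hαp, abs_mul, abs_of_nonneg (hα0 a)]
        exact Real.rpow_le_rpow (mul_nonneg (hα0 a) (abs_nonneg _))
          (mul_le_of_le_one_right (hα0 a) hc) hp.le
    have h := abs_frob_vecMulVec_le_one hp hm hn hZ
      (x := fun i => α (Sum.inl i) * s i) (y := fun j => α (Sum.inr j) * t j)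
      ((Finset.sum_le_sum fun i _ => key _ _ (hs i)).trans hX.left)
      ((Finset.sum_le_sum fun j _ => key _ _ (ht j)).trans hX.right)
    convert h using 2
    refine Finset.sum_congr rfl fun i _ => Finset.sum_congr rfl fun j _ => ?_
    rw [vecMulVec_apply]
    ring
  have h := hK m n d (of fun i j => Z i j * (α (Sum.inl i) * α (Sum.inr j))) hC
    (fun i => e (Sum.inl i)) (fun j => e (Sum.inr j)) (fun i => he _) (fun j => he _)
  have hXe : ∀ a b, X a b = α a * α b * inner ℝ (e a) (e b) := fun a b => by
    rw [hg, PiLp.inner_apply, Finset.mul_sum]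
    refine Finset.sum_congr rfl fun k _ => ?_
    simp only [e, RCLike.inner_apply, conj_trivial]
    calc g a k * g b k = α a * ((α a)⁻¹ * g a k) * (α b * ((α b)⁻¹ * g b k)) := by rw [hαg, hαg]
      _ = _ := by ring
  rw [frob_symBlock Z hX.psd]
  refine (le_of_eq ?_).trans ((le_abs_self _).trans h)
  refine Finset.sum_congr rfl fun i _ => Finset.sum_congr rfl fun j _ => ?_
  rw [of_apply, hXe, mul_assoc, mul_assoc, mul_assoc]

/-! ### The nuclear norm -/

theorem exists_decomposition {p : ℝ} (hp : 0 < p) {m n : ℕ} (hm : 0 < m) (hn : 0 < n)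
    (A : Matrix (Fin m) (Fin n) ℝ) :
    ∃ r : ℕ, 0 < r ∧ ∃ (lam : Fin r → ℝ) (x : Fin r → Fin m → ℝ) (y : Fin r → Fin n → ℝ),
      (∀ i, ellNorm p (x i) = 1) ∧ (∀ i, ellNorm p (y i) = 1) ∧
      A = ∑ i, lam i • vecMulVec (x i) (y i) := by
  refine ⟨m * n, Nat.mul_pos hm hn, fun k => A (finProdFinEquiv.symm k).1 (finProdFinEquiv.symm k).2,
    fun k => Pi.single (finProdFinEquiv.symm k).1 1,
    fun k => Pi.single (finProdFinEquiv.symm k).2 1,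
    fun k => (ellNorm_eq_one_iff hp).2 (sum_abs_single_rpow hp _ abs_one),
    fun k => (ellNorm_eq_one_iff hp).2 (sum_abs_single_rpow hp _ abs_one), ?_⟩
  rw [finProdFinEquiv.symm.sum_comp fun k : Fin m × Fin n =>
    A k.1 k.2 • vecMulVec (Pi.single k.1 (1 : ℝ)) (Pi.single k.2 (1 : ℝ)), Fintype.sum_prod_type]
  conv_lhs => rw [matrix_eq_sum_single A]
  refine Finset.sum_congr rfl fun i _ => Finset.sum_congr rfl fun j _ => ?_
  rw [← single_eq_single_vecMulVec_single, smul_single, smul_eq_mul, mul_one]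

theorem nuclearPNorm_le_of_eq_sum {p : ℝ} {m n : ℕ} {A : Matrix (Fin m) (Fin n) ℝ} {σ : Type*}
    [Fintype σ] [Nonempty σ] {lam : σ → ℝ} {x : σ → Fin m → ℝ} {y : σ → Fin n → ℝ}
    (hx : ∀ i, ellNorm p (x i) = 1) (hy : ∀ i, ellNorm p (y i) = 1)
    (hA : A = ∑ i, lam i • vecMulVec (x i) (y i)) : nuclearPNorm p A ≤ ∑ i, |lam i| := by
  let e := Fintype.equivFin σ
  refine csInf_le ⟨0, ?_⟩ ⟨Fintype.card σ, Fintype.card_pos, lam ∘ e.symm, x ∘ e.symm, y ∘ e.symm,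
    fun i => hx _, fun i => hy _, ?_, ?_⟩
  · rintro _ ⟨r, -, lam, -, -, -, -, -, rfl⟩
    exact Finset.sum_nonneg fun i _ => abs_nonneg _
  · exact hA.trans (e.symm.sum_comp fun i => lam i • vecMulVec (x i) (y i)).symm
  · exact (e.symm.sum_comp fun i => |lam i|).symm

theorem le_nuclearPNorm {p : ℝ} (hp : 0 < p) {m n : ℕ} (hm : 0 < m) (hn : 0 < n)
    {A : Matrix (Fin m) (Fin n) ℝ} {c : ℝ}
    (h : ∀ (r : ℕ) (lam : Fin r → ℝ) (x : Fin r → Fin m → ℝ) (y : Fin r → Fin n → ℝ), 0 < r →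
      (∀ i, ellNorm p (x i) = 1) → (∀ i, ellNorm p (y i) = 1) →
      A = ∑ i, lam i • vecMulVec (x i) (y i) → c ≤ ∑ i, |lam i|) : c ≤ nuclearPNorm p A := by
  obtain ⟨r, hr, lam, x, y, hx, hy, hA⟩ := exists_decomposition hp hm hn A
  refine le_csInf ⟨_, r, hr, lam, x, y, hx, hy, hA, rfl⟩ ?_
  rintro _ ⟨r, hr, lam, x, y, hx, hy, hA, rfl⟩
  exact h r lam x y hr hx hy hA

theorem nuclearPNorm_nonneg {p : ℝ} (hp : 0 < p) {m n : ℕ} (hm : 0 < m) (hn : 0 < n)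
    (A : Matrix (Fin m) (Fin n) ℝ) : 0 ≤ nuclearPNorm p A :=
  le_nuclearPNorm hp hm hn fun _ _ _ _ _ _ _ _ => Finset.sum_nonneg fun _ _ => abs_nonneg _

theorem nuclearPNorm_smul_le {p : ℝ} (hp : 0 < p) {m n : ℕ} (hm : 0 < m) (hn : 0 < n) {c : ℝ}
    (hc : 0 < c) (A : Matrix (Fin m) (Fin n) ℝ) :
    nuclearPNorm p (c • A) ≤ c * nuclearPNorm p A := by
  rw [← div_le_iff₀' hc]
  refine le_nuclearPNorm hp hm hn fun r lam x y hr hx hy hA => ?_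
  have : Nonempty (Fin r) := ⟨⟨0, hr⟩⟩
  rw [div_le_iff₀' hc, Finset.mul_sum]
  refine (nuclearPNorm_le_of_eq_sum (lam := fun i => c * lam i) hx hy ?_).trans (le_of_eq ?_)
  · rw [hA, Finset.smul_sum]
    exact Finset.sum_congr rfl fun i _ => smul_smul _ _ _
  · exact Finset.sum_congr rfl fun i _ => by rw [abs_mul, abs_of_pos hc]

theorem nuclearPNorm_smul {p : ℝ} (hp : 0 < p) {m n : ℕ} (hm : 0 < m) (hn : 0 < n) {c : ℝ}
    (hc : 0 < c) (A : Matrix (Fin m) (Fin n) ℝ) :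
    nuclearPNorm p (c • A) = c * nuclearPNorm p A := by
  refine (nuclearPNorm_smul_le hp hm hn hc A).antisymm ?_
  have h := nuclearPNorm_smul_le hp hm hn (inv_pos.2 hc) (c • A)
  rwa [smul_smul, inv_mul_cancel₀ hc.ne', one_smul, le_inv_mul_iff₀ hc] at h

theorem nuclearPNorm_add_le {p : ℝ} (hp : 0 < p) {m n : ℕ} (hm : 0 < m) (hn : 0 < n)
    (A B : Matrix (Fin m) (Fin n) ℝ) :
    nuclearPNorm p (A + B) ≤ nuclearPNorm p A + nuclearPNorm p B := by
  rw [← sub_le_iff_le_add]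
  refine le_nuclearPNorm hp hm hn fun r lam x y hr hx hy hA => ?_
  rw [sub_le_comm]
  refine le_nuclearPNorm hp hm hn fun r' lam' x' y' hr' hx' hy' hB => ?_
  have : Nonempty (Fin r) := ⟨⟨0, hr⟩⟩
  rw [sub_le_iff_le_add']
  refine (nuclearPNorm_le_of_eq_sum (lam := Sum.elim lam lam') (x := Sum.elim x x')
    (y := Sum.elim y y') ?_ ?_ ?_).trans (le_of_eq ?_)
  · rintro (i | i)
    exacts [hx i, hx' i]
  · rintro (i | i)
    exacts [hy i, hy' i]
  · rw [hA, hB, Fintype.sum_sum_type]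
    rfl
  · rw [Fintype.sum_sum_type]
    rfl

theorem nuclearPNorm_vecMulVec_le_one {p : ℝ} {m n : ℕ} {x : Fin m → ℝ} {y : Fin n → ℝ}
    (hx : ellNorm p x = 1) (hy : ellNorm p y = 1) : nuclearPNorm p (vecMulVec x y) ≤ 1 := by
  simpa using nuclearPNorm_le_of_eq_sum (σ := Unit) (lam := fun _ => 1) (x := fun _ => x)
    (y := fun _ => y) (fun _ => hx) (fun _ => hy) (by simp)

theorem exists_eq_frob {m n : ℕ} (g : Matrix (Fin m) (Fin n) ℝ →ₗ[ℝ] ℝ) :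
    ∃ Z, ∀ B, g B = frob B Z := by
  refine ⟨of fun i j => g (single i j 1), fun B => ?_⟩
  conv_lhs => rw [matrix_eq_sum_single B]
  simp only [map_sum, frob, of_apply]
  refine Finset.sum_congr rfl fun i _ => Finset.sum_congr rfl fun j _ => ?_
  rw [← smul_eq_mul, ← map_smul, smul_single, smul_eq_mul, mul_one]

/-- The nuclear norm of `A` is its pairing with some `Z` in the unit ball of the spectral norm, by the
Hahn–Banach theorem. -/
theorem exists_frob_eq_nuclearPNorm {p : ℝ} (hp : 0 < p) {m n : ℕ} (hm : 0 < m) (hn : 0 < n)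
    (A : Matrix (Fin m) (Fin n) ℝ) :
    ∃ Z : Matrix (Fin m) (Fin n) ℝ, frob A Z = nuclearPNorm p A ∧
      ∀ (x : Fin m → ℝ) (y : Fin n → ℝ), ∑ i, |x i| ^ p = 1 → ∑ j, |y j| ^ p = 1 →
        frob Z (vecMulVec x y) ≤ 1 := by
  have hzero : nuclearPNorm p (0 : Matrix (Fin m) (Fin n) ℝ) = 0 := by
    have := nuclearPNorm_smul hp hm hn (two_pos (α := ℝ)) (0 : Matrix (Fin m) (Fin n) ℝ)
    rw [smul_zero] at this
    linarith
  by_cases hA : A = 0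
  · refine ⟨0, by rw [hA, hzero]; simp [frob], fun x y _ _ => by simp [frob]⟩
  obtain ⟨g, hgA, hg⟩ := exists_extension_of_le_sublinear
    (LinearPMap.mkSpanSingleton A (nuclearPNorm p A) hA) (nuclearPNorm p)
    (fun c hc B => nuclearPNorm_smul hp hm hn hc B) (nuclearPNorm_add_le hp hm hn) (by
      rintro ⟨B, hB⟩
      obtain ⟨c, rfl⟩ := Submodule.mem_span_singleton.1 hB
      rw [LinearPMap.mkSpanSingleton'_apply, smul_eq_mul]
      rcases lt_trichotomy c 0 with hc | rfl | hc
      · exact (mul_nonpos_of_nonpos_of_nonneg hc.le (nuclearPNorm_nonneg hp hm hn A)).trans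
          (nuclearPNorm_nonneg hp hm hn _)
      · simp [hzero]
      · exact (nuclearPNorm_smul hp hm hn hc A).ge)
  obtain ⟨Z, hZ⟩ := exists_eq_frob g
  refine ⟨Z, ?_, fun x y hx hy => ?_⟩
  · rw [← hZ]
    have := hgA ⟨A, Submodule.mem_span_singleton_self A⟩
    rw [this, LinearPMap.mkSpanSingleton_apply]
  · rw [frob_comm, ← hZ]
    exact (hg _).trans (nuclearPNorm_vecMulVec_le_one ((ellNorm_eq_one_iff hp).2 hx)
      ((ellNorm_eq_one_iff hp).2 hy))

theorem uNorm_le_nuclearPNorm {p : ℝ} (hp : 0 < p) {m n : ℕ} (hm : 0 < m) (hn : 0 < n)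
    (A : Matrix (Fin m) (Fin n) ℝ) : uNorm p A ≤ nuclearPNorm p A := by
  obtain ⟨Z, hZ, hZA⟩ := (isGreatest_uNorm hp A).1
  rw [← hZA]
  refine le_nuclearPNorm hp hm hn fun r lam x y _ hx hy hA => ?_
  rw [hA, frob_sum_left]
  refine Finset.sum_le_sum fun i _ => ?_
  have hx' := (ellNorm_eq_one_iff hp).1 (hx i)
  have hy' := (ellNorm_eq_one_iff hp).1 (hy i)
  have h : |frob Z (vecMulVec (x i) (y i))| ≤ 1 :=
    abs_frob_vecMulVec_le_one hp hm hn
      (fun x y hx hy => (frob_vecMulVec_le_vNorm hp Z hx.le hy.le).trans hZ) hx'.le hy'.le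
  rw [frob_smul_left, frob_comm]
  refine (le_abs_self _).trans ?_
  rw [abs_mul]
  exact mul_le_of_le_one_right (abs_nonneg _) h

theorem nuclearPNorm_le_mul_uNorm {p : ℝ} (hp : 0 < p) {m n : ℕ} (hm : 0 < m) (hn : 0 < n)
    (A : Matrix (Fin m) (Fin n) ℝ) : nuclearPNorm p A ≤ grothendieckConstant * uNorm p A := by
  obtain ⟨Z, hZA, hZ⟩ := exists_frob_eq_nuclearPNorm hp hm hn A
  have hv := vNorm_le_of_frob_vecMulVec_le hp hm hn isGrothendieckBound_grothendieckConstant hZ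
  have hG : 0 < grothendieckConstant := zero_lt_one.trans_le one_le_grothendieckConstant
  have h : vNorm p (grothendieckConstant⁻¹ • Z) ≤ 1 := by
    refine vNorm_le hp fun X hX => ?_
    have e : frob (symBlock (grothendieckConstant⁻¹ • Z)) X =
        grothendieckConstant⁻¹ * frob (symBlock Z) X := by
      rw [frob_symBlock _ hX.psd, frob_symBlock _ hX.psd, Finset.mul_sum]
      refine Finset.sum_congr rfl fun i _ => ?_
      rw [Finset.mul_sum]
      exact Finset.sum_congr rfl fun j _ => by rw [Matrix.smul_apply, smul_eq_mul, mul_assoc]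
    rw [e, inv_mul_le_iff₀ hG, mul_one]
    exact (hX.frob_le_vNorm hp Z).trans hv
  have := frob_le_uNorm hp (A := A) h
  rwa [frob_smul_right, inv_mul_le_iff₀ hG, hZA] at this

theorem spectralPNorm_le_one {p : ℝ} (hp : 0 < p) {m n : ℕ} {Z : Matrix (Fin m) (Fin n) ℝ}
    (hZ : vNorm p Z ≤ 1) : spectralPNorm p Z ≤ 1 := by
  refine Real.sSup_le ?_ zero_le_one
  rintro _ ⟨x, y, hx, hy, rfl⟩
  exact (frob_vecMulVec_le_vNorm hp Z ((ellNorm_eq_one_iff hp).1 hx).le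
    ((ellNorm_eq_one_iff hp).1 hy).le).trans hZ

end NuclearP

theorem mainTheorem1 (p : ℚ) (hp : 2 < p) :
    -- the second-order cone system represents the cone `v^{p/(p-2)} ≤ t u^{2/(p-2)}`
    NuclearP.socCone p =
      {w : ℝ × ℝ × ℝ | 0 ≤ w.1 ∧ 0 ≤ w.2.1 ∧ 0 ≤ w.2.2 ∧
        w.2.1 ^ ((p : ℝ) / ((p : ℝ) - 2)) ≤ w.2.2 * w.1 ^ (2 / ((p : ℝ) - 2))} ∧
    ∀ (m n : ℕ) (_hm : 0 < m) (_hn : 0 < n) (A : Matrix (Fin m) (Fin n) ℝ),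
      -- the two conic programs attain their optimal values `‖A‖_{p_v}` and `‖A‖_{p_u}`
      IsLeast (NuclearP.vProgramValues p A) (NuclearP.vNorm p A) ∧
      IsGreatest (NuclearP.frob A '' NuclearP.uProgramFeasible p m n) (NuclearP.uNorm p A) ∧
      -- approximation of the nuclear `p`-norm
      NuclearP.uNorm p A ≤ NuclearP.nuclearPNorm p A ∧
      NuclearP.nuclearPNorm p A ≤ NuclearP.grothendieckConstant * NuclearP.uNorm p A ∧
      -- approximate dual certificates
      ∀ Z : Matrix (Fin m) (Fin n) ℝ, NuclearP.IsOptimalZ p A Z →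
        NuclearP.spectralPNorm p Z ≤ 1 ∧
        NuclearP.nuclearPNorm p A / NuclearP.grothendieckConstant ≤ NuclearP.frob A Z := by
  refine ⟨Set.ext fun w => NuclearP.mem_socCone_iff hp, fun m n hm hn A => ?_⟩
  have hp0 : (0 : ℝ) < p := by exact_mod_cast (by linarith : (0 : ℚ) < p)
  have hfeas : NuclearP.uProgramFeasible p m n = {Z | NuclearP.vNorm p Z ≤ 1} :=
    Set.ext fun Z => NuclearP.mem_uProgramFeasible_iff hp hm hn
  have hgreatest := NuclearP.isGreatest_uNorm hp0 A
  have hle := NuclearP.nuclearPNorm_le_mul_uNorm hp0 hm hn A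
  refine ⟨NuclearP.isLeast_vProgramValues hp hm hn A, hfeas ▸ hgreatest,
    NuclearP.uNorm_le_nuclearPNorm hp0 hm hn A, hle, fun Z hZ => ?_⟩
  obtain ⟨hZ, hopt⟩ := hZ
  rw [hfeas] at hZ hopt
  refine ⟨NuclearP.spectralPNorm_le_one hp0 hZ, ?_⟩
  obtain ⟨Z', hZ', he⟩ := hgreatest.1
  have hG : 0 < NuclearP.grothendieckConstant :=
    zero_lt_one.trans_le NuclearP.one_le_grothendieckConstant
  rw [div_le_iff₀' hG]
  refine hle.trans (mul_le_mul_of_nonneg_left ?_ hG.le)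
  rw [← he]
  exact hopt Z' hZ'
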